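/- Let $K\ge 1$ and let $\mathcal X_1,\dots,\mathcal X_K$ (non-empty), $\mathcal Y_1,\dots,\mathcal Y_K$ and $\mathcal V$ be measurable spaces (for example finite sets, or Euclidean spaces). Write $X_{\mathcal K_1}=(X_2,\dots,X_K)$. A memoryless many-to-one interference channel is given by transition probabilities $p_{Y_i|X_i}$ for $i=2,\dots,K$ and $p_{V|X_{\mathcal K_1}}$, which are marginals of some joint transition probability of $(V,Y_2,\dots,Y_K)$ given $X_{\mathcal K_1}$, and by a measurable function $f_1$ such that $Y_1=f_1(X_1,V)$ and $V$ is a measurable function of $(Y_1,X_1)$. The channel uses at different times are independent given the inputs. A code of length $T\ge 1$ has, for each user $i$, a finite message set $\mathcal W_i$, an encoder $\phi_i:\mathcal W_i\to\mathcal X_i^T$ and a measurable decoder $\psi_i:\mathcal Y_i^T\to\mathcal W_i$; the messages are independent and uniform, the error probability is $\Pr(\exists i:\psi_i(Y_i^T)\ne W_i)$, and the rates are $R_i=\frac1T\log|\mathcal W_i|$. A rate tuple is achievable if there is a sequence of codes, all of exactly these rates, with error probability tending to $0$; $\mathcal C$ is the closure of the set of achievable rate tuples, and $C_\Sigma=\sup_{R\in\mathcal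 C}\sum_{i=1}^K R_i\in[0,\infty]$. Suppose that $p_{V|X_{\mathcal K_1}}$ is a stochastically degraded version of $\prod_{i=2}^K p_{Y_i|X_i}$, that is, there is a transition probability from $\mathcal Y_2\times\dots\times\mathcal Y_K$ to $\mathcal V$ which, applied to outputs $Y_2,\dots,Y_K$ that are conditionally independent given $X_{\mathcal K_1}$ with laws $p_{Y_i|X_i}$, gives $p_{V|X_{\mathcal K_1}}$. Then $$C_\Sigma=\sup_{p_{X_1},\dots,p_{X_K}}\ \sum_{i=1}^K I(X_i;Y_i),$$ where the supremum is over all product probability distributions $\prod_i p_{X_i}$ of the inputs. Moreover, $C_\Sigma$ is achieved by random coding with interference treated as noise. Given input laws $p_{X_i}$ and rates $R_i\ge0$, let user $i$ have $\lceil e^{TR_i}\rceil$ codewords of length $T$, all symbols of all codewords of all users being independent and those of user $i$ having law $p_{X_i}$; let receiver $i$, using only its own codebook and the single-letter joint law of $(X_i,Y_i)$, choose the unique message whose codeword $x^T$ satisfies $\prod_{\tau=1}^{T}\frac{dP_{X_iY_i}}{d(P_{X_i}\times P_{Y_i})}(x(\tau),y(\tau))>e^{T\gamma_i}$ for a fixed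 threshold $\gamma_i$ (and a fixed message if there is no such unique message). Say that $(R_i)$ is achieved if for some thresholds the error probability averaged over the codebooks tends to $0$ as $T\to\infty$. Then all rates with $R_i=0$ or $0\le R_i<I(X_i;Y_i)$ for each $i$ are achieved, and $C_\Sigma$ is the supremum of $\sum_iR_i$ over all input laws and all rate tuples achieved in this way. If all $\mathcal X_i$ are finite (with all subsets measurable), then the supremum over product input distributions is finite and attained, and it equals $\max_{R\in\mathcal C}\sum_iR_i$. -/

import Mathlib

open MeasureTheory ProbabilityTheory Filter Topology
open scoped ENNReal

noncomputable section

/-! ## Single-letter information quantities -/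

/-- Mutual information (in nats) of the two coordinates of a joint law `P`: the Kullback-Leibler
divergence of `P` from the product of its marginals. -/
def mutualInformation {A B : Type*} [MeasurableSpace A] [MeasurableSpace B]
    (P : Measure (A × B)) : ℝ≥0∞ :=
  InformationTheory.klDiv P (P.fst.prod P.snd)

/-- The likelihood ratio `dP/dQ` of a joint law `P` against the product `Q` of its marginals, with
values in `[0, ∞]`: the quotient of the densities of `P` and `Q` with respect to `P + Q`. It equals
`∞` on the part of `P` that is singular to `Q`. -/
def likelihoodRatio {A B : Type*} [MeasurableSpace A] [MeasurableSpace B]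
    (P : Measure (A × B)) (z : A × B) : ℝ≥0∞ :=
  P.rnDeriv (P + P.fst.prod P.snd) z /
    (P.fst.prod P.snd).rnDeriv (P + P.fst.prod P.snd) z

/-- A codeword `x` and an output block `y` of length `T` are typical for the joint law `P` at
level `γ` if their information density is greater than `T * γ`, that is,
`∏ τ, (dP/dQ)(x τ, y τ) > exp (T * γ)`. -/
def IsTypical {A B : Type*} [MeasurableSpace A] [MeasurableSpace B]
    (P : Measure (A × B)) (γ : ℝ) {T : ℕ} (x : Fin T → A) (y : Fin T → B) : Prop :=
  ENNReal.ofReal (Real.exp (T * γ)) < ∏ τ, likelihoodRatio P (x τ, y τ)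

open Classical in
/-- Typicality decoding with a codebook `cb`: the output is the unique message whose codeword is
typical with the received block, and message `0` if there is no such message or more than one. -/
def typicalityDecoder {A B : Type*} [MeasurableSpace A] [MeasurableSpace B]
    (P : Measure (A × B)) (γ : ℝ) {T M : ℕ} [NeZero M] (cb : Fin M → Fin T → A)
    (y : Fin T → B) : Fin M :=
  if h : ∃! w, IsTypical P γ (cb w) y then h.choose else 0

/-- Number of messages `⌈exp (T * R)⌉` used at rate `R` (in nats) and block length `T`. -/
def messageCount (R : ℝ) (T : ℕ) : ℕ := ⌈Real.exp (T * R)⌉₊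

instance messageCount_neZero (R : ℝ) (T : ℕ) : NeZero (messageCount R T) :=
  ⟨(Nat.ceil_pos.2 (Real.exp_pos _)).ne'⟩

/-! ## The channel -/

/-- A memoryless many-to-one interference channel with `n + 1` users, given by its one-symbol
behaviour. User `0` is the one whose receiver faces interference; the users `i.succ`,
`i : Fin n`, are the others. -/
structure ManyToOneChannel (n : ℕ) (X Y : Fin (n + 1) → Type*) (V : Type*)
    [∀ i, MeasurableSpace (X i)] [∀ i, MeasurableSpace (Y i)] [MeasurableSpace V] where
  /-- The transition law of the direct link of user `i.succ`. -/
  direct : ∀ i : Fin n, Kernel (X i.succ) (Y i.succ)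
  markov_direct : ∀ i, IsMarkovKernel (direct i)
  /-- The joint law of the interference `V` and of the outputs of the users `i.succ`, given the
  inputs of these users. -/
  law : Kernel (∀ i : Fin n, X i.succ) (V × ∀ i : Fin n, Y i.succ)
  markov_law : IsMarkovKernel law
  /-- Given all inputs, the output of user `i.succ` has the law of its direct link. -/
  law_output : ∀ (x : ∀ i : Fin n, X i.succ) (i : Fin n),
    (law x).map (fun q => q.2 i) = direct i (x i)
  /-- The output of user `0` is `f (X₀, V)`. -/
  f : X 0 × V → Y 0
  measurable_f : Measurable f
  /-- The interference is a function of the output and of the input of user `0`. -/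
  invertible : ∃ g : Y 0 × X 0 → V, Measurable g ∧ ∀ x v, g (f (x, v), x) = v

namespace ManyToOneChannel

variable {n : ℕ} {X Y : Fin (n + 1) → Type*} {V : Type*}
  [∀ i, MeasurableSpace (X i)] [∀ i, MeasurableSpace (Y i)] [MeasurableSpace V]

attribute [instance] markov_direct markov_law

/-- The law of the interference `V` given the inputs of the users `i.succ`. -/
def interference (C : ManyToOneChannel n X Y V) : Kernel (∀ i : Fin n, X i.succ) V :=
  C.law.fst

/-- `p(v | x)` is a (stochastically) degraded version of `∏ i, p(y i | x i)`: it is obtained from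
the independent outputs of the direct links by passing them through some channel. -/
def IsDegraded (C : ManyToOneChannel n X Y V) : Prop :=
  ∃ D : Kernel (∀ i : Fin n, Y i.succ) V, IsMarkovKernel D ∧
    ∀ x : ∀ i : Fin n, X i.succ,
      C.interference x = (Measure.pi fun i => C.direct i (x i)).bind D

/-- The tuple of all outputs, as a function of all inputs, the interference and the outputs of the
users `i.succ`. -/
def assemble (C : ManyToOneChannel n X Y V)
    (q : (∀ i, X i) × (V × ∀ i : Fin n, Y i.succ)) : ∀ i, Y i :=
  Fin.cons (C.f (q.1 0, q.2.1)) q.2.2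

lemma measurable_assemble (C : ManyToOneChannel n X Y V) : Measurable C.assemble := by
  refine measurable_pi_lambda _ fun i => ?_
  refine Fin.cases ?_ (fun j => ?_) i
  · exact C.measurable_f.comp
      (((measurable_pi_apply 0).comp measurable_fst).prodMk (measurable_fst.comp measurable_snd))
  · exact (measurable_pi_apply j).comp (measurable_snd.comp measurable_snd)

/-- The one-symbol channel from all inputs to all outputs. -/
def channel (C : ManyToOneChannel n X Y V) : Kernel (∀ i, X i) (∀ i, Y i) :=
  (Kernel.id ×ₖ C.law.comap (fun (x : ∀ i, X i) (i : Fin n) => x i.succ)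
    (measurable_pi_lambda _ fun i => measurable_pi_apply i.succ)).map C.assemble

instance (C : ManyToOneChannel n X Y V) : IsMarkovKernel C.channel :=
  Kernel.IsMarkovKernel.map _ C.measurable_assemble

/-! ## Codes, error probability, capacity -/

/-- Average probability (over independent uniform messages and over `T` memoryless uses of the
channel) that some receiver `i` does not decode the message of user `i`, for the encoders `enc`
and the decoders `dec`. -/
def errorProb (C : ManyToOneChannel n X Y V) {T : ℕ} {M : Fin (n + 1) → ℕ}
    (enc : ∀ i, Fin (M i) → Fin T → X i) (dec : ∀ i, (Fin T → Y i) → Fin (M i)) : ℝ≥0∞ :=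
  (∏ i, (M i : ℝ≥0∞))⁻¹ * ∑ w : ∀ i, Fin (M i),
    (Measure.pi fun τ : Fin T => C.channel fun i => enc i (w i) τ)
      {y | ∃ i, dec i (fun τ => y τ i) ≠ w i}

/-- The rate tuple `R` (in nats per symbol) is achievable: there is a sequence of codes, all of
rate `R`, whose average probability of error vanishes. -/
def Achievable (C : ManyToOneChannel n X Y V) (R : Fin (n + 1) → ℝ) : Prop :=
  ∃ (T : ℕ → ℕ) (M : ℕ → Fin (n + 1) → ℕ)
    (enc : ∀ k i, Fin (M k i) → Fin (T k) → X i)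
    (dec : ∀ k i, (Fin (T k) → Y i) → Fin (M k i)),
    (∀ k, 0 < T k) ∧ (∀ k i, 0 < M k i) ∧ (∀ k i, Measurable (dec k i)) ∧
    (∀ k i, R i = Real.log (M k i) / T k) ∧
    Tendsto (fun k => C.errorProb (enc k) (dec k)) atTop (𝓝 0)

/-- The capacity region: the closure of the set of achievable rate tuples. -/
def capacityRegion (C : ManyToOneChannel n X Y V) : Set (Fin (n + 1) → ℝ) :=
  closure {R | C.Achievable R}

/-- The sum-capacity, in `[0, ∞]`. -/
def sumCapacity (C : ManyToOneChannel n X Y V) : ℝ≥0∞ :=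
  ⨆ R ∈ C.capacityRegion, ENNReal.ofReal (∑ i, R i)

/-! ## Single-letter rates, random coding, interference treated as noise -/

/-- The joint law of the input and the output of user `i` when the inputs of all users are
independent with laws `p`. -/
def userLaw (C : ManyToOneChannel n X Y V) (p : ∀ i, ProbabilityMeasure (X i))
    (i : Fin (n + 1)) : Measure (X i × Y i) :=
  ((Measure.pi fun j => (p j : Measure (X j))) ⊗ₘ C.channel).map fun z => (z.1 i, z.2 i)

/-- `I(X i; Y i)` when the inputs of all users are independent with laws `p`. -/
def userInfo (C : ManyToOneChannel n X Y V) (p : ∀ i, ProbabilityMeasure (X i))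
    (i : Fin (n + 1)) : ℝ≥0∞ :=
  mutualInformation (C.userLaw p i)

/-- The law of the random codebooks: all symbols of all codewords of all users are independent,
those of user `i` having law `p i`. -/
def codebookLaw (p : ∀ i, ProbabilityMeasure (X i)) (T : ℕ) (M : Fin (n + 1) → ℕ) :
    Measure (∀ i, Fin (M i) → Fin T → X i) :=
  Measure.pi fun i => Measure.pi fun _ => Measure.pi fun _ => (p i : Measure (X i))

/-- Random coding with input laws `p` and with interference treated as noise achieves the rate
tuple `R`: the average of the error probability over the random codebooks vanishes as the block
length increases, when each receiver `i` applies typicality decoding with its own codebook only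
and with the single-letter law of `(X i, Y i)`. -/
def RandomCodingAchieves (C : ManyToOneChannel n X Y V) (p : ∀ i, ProbabilityMeasure (X i))
    (R : Fin (n + 1) → ℝ) : Prop :=
  (∀ i, 0 ≤ R i) ∧ ∃ γ : Fin (n + 1) → ℝ,
    Tendsto (fun T : ℕ =>
      ∫⁻ cb, C.errorProb cb (fun i => typicalityDecoder (C.userLaw p i) (γ i) (cb i))
        ∂(codebookLaw p T fun i => messageCount (R i) T)) atTop (𝓝 0)

end ManyToOneChannel

end

/-!
**Converse.** Fano's inequality, applied to the uniform messages as inputs of the `T`-fold channel,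
bounds `T ∑ R i` by `∑ I(W i; Y i ^ T)`. Receiver `0` knows its own input, so that its output is as
good as the interference `V ^ T`, whereas the single-letter bound treats `V` as memoryless noise.
The gain of receiver `0` from the memory of `V ^ T` is a divergence between the law of `V ^ T` and
the product of its marginals. Since `V` is a degraded version of the outputs of the other users,
data processing bounds this gain by the corresponding divergences for `Y i ^ T`, `i ≠ 0`, and by the
chain rule these are exactly what the other users lose against `∑ τ, I(X i τ; Y i τ)`.

**Achievability.** The true codeword is typical by a Chernoff bound for a small negative moment of
the likelihood ratio, whose derivative at `0` is the divergence; a wrong codeword is independent of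
the output, so that it is typical with probability at most `exp (-T γ)`. A rate tuple in the region
of all `R i < I(X i; Y i)` is thus achieved by typicality decoding, whatever the dependence between
the outputs of the receivers.

**Finite alphabets.** The mutual informations are continuous on the compact product of the simplices
of input laws: all joint laws have bounded densities, depending continuously on the input laws, with
respect to the product of the marginals that belong to uniform inputs.
-/

noncomputable section

/-! ## Finite products of measures and kernels -/

section Pi

variable {ι : Type*} [Fintype ι] {A B : ι → Type*} [∀ i, MeasurableSpace (A i)]
  [∀ i, MeasurableSpace (B i)]

lemma lintegral_fintype_prod_eq_prod (μ : ∀ i, Measure (A i)) [∀ i, IsProbabilityMeasure (μ i)]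
    {f : ∀ i, A i → ℝ≥0∞} (hf : ∀ i, Measurable (f i)) :
    ∫⁻ x, ∏ i, f i (x i) ∂(Measure.pi μ) = ∏ i, ∫⁻ a, f i a ∂(μ i) := by
  rw [lintegral_prod_eq_prod_lintegral_of_indepFun Finset.univ (fun i (x : ∀ i, A i) => f i (x i))
    (iIndepFun_pi fun i => (hf i).aemeasurable) fun i => (hf i).comp (measurable_pi_apply i)]
  exact Finset.prod_congr rfl fun i _ => (measurePreserving_eval μ i).lintegral_comp (hf i)

lemma pi_withDensity (q : ∀ i, Measure (A i)) [∀ i, IsProbabilityMeasure (q i)]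
    {r : ∀ i, A i → ℝ≥0∞} (hr : ∀ i, Measurable (r i))
    [∀ i, SigmaFinite ((q i).withDensity (r i))] :
    Measure.pi (fun i => (q i).withDensity (r i)) =
      (Measure.pi q).withDensity fun x => ∏ i, r i (x i) := by
  refine Measure.pi_eq fun s hs => ?_
  have hbox (x : ∀ i, A i) : (Set.univ.pi s).indicator (fun x => ∏ i, r i (x i)) x =
      ∏ i, (s i).indicator (r i) (x i) := by
    classical
    simp only [Set.indicator_apply, Set.mem_univ_pi]
    split_ifs with hx
    · exact Finset.prod_congr rfl fun i _ => (if_pos (hx i)).symm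
    · obtain ⟨i, hi⟩ := not_forall.1 hx
      exact (Finset.prod_eq_zero (Finset.mem_univ i) (if_neg hi)).symm
  rw [withDensity_apply _ (MeasurableSet.univ_pi hs),
    ← lintegral_indicator (MeasurableSet.univ_pi hs), lintegral_congr hbox,
    lintegral_fintype_prod_eq_prod q fun i => (hr i).indicator (hs i)]
  exact Finset.prod_congr rfl fun i _ => by
    rw [lintegral_indicator (hs i), withDensity_apply _ (hs i)]

section Density

variable {m q : ∀ i, Measure (A i)} [∀ i, IsProbabilityMeasure (m i)]
  [∀ i, IsProbabilityMeasure (q i)]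

lemma pi_eq_withDensity_rnDeriv (h : ∀ i, m i ≪ q i) :
    Measure.pi m = (Measure.pi q).withDensity fun x => ∏ i, (m i).rnDeriv (q i) (x i) := by
  have hm (i) : (q i).withDensity ((m i).rnDeriv (q i)) = m i :=
    Measure.withDensity_rnDeriv_eq _ _ (h i)
  have (i : ι) : SigmaFinite ((q i).withDensity ((m i).rnDeriv (q i))) := by
    rw [hm i]; infer_instance
  rw [← pi_withDensity q fun i => Measure.measurable_rnDeriv (m i) (q i)]
  simp_rw [hm]

lemma absolutelyContinuous_pi (h : ∀ i, m i ≪ q i) : Measure.pi m ≪ Measure.pi q := by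
  rw [pi_eq_withDensity_rnDeriv h]
  exact withDensity_absolutelyContinuous _ _

lemma rnDeriv_pi (h : ∀ i, m i ≪ q i) :
    (Measure.pi m).rnDeriv (Measure.pi q) =ᵐ[Measure.pi q]
      fun x => ∏ i, (m i).rnDeriv (q i) (x i) := by
  conv_lhs => rw [pi_eq_withDensity_rnDeriv h]
  exact Measure.rnDeriv_withDensity _ (Finset.measurable_prod _ fun i _ =>
    (Measure.measurable_rnDeriv _ _).comp (measurable_pi_apply i))

lemma llr_pi (h : ∀ i, m i ≪ q i) :
    llr (Measure.pi m) (Measure.pi q) =ᵐ[Measure.pi m] fun x => ∑ i, llr (m i) (q i) (x i) := by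
  have hpos : ∀ᵐ x ∂(Measure.pi m), ∀ i, 0 < ((m i).rnDeriv (q i) (x i)).toReal := by
    refine eventually_all.2 fun i => Measure.tendsto_eval_ae_ae.eventually
      (p := fun a => 0 < ((m i).rnDeriv (q i) a).toReal) ?_
    filter_upwards [Measure.rnDeriv_pos (h i), h i (Measure.rnDeriv_lt_top (m i) (q i))]
      with a h₀ h₁ using ENNReal.toReal_pos h₀.ne' h₁.ne
  filter_upwards [absolutelyContinuous_pi h (rnDeriv_pi h), hpos] with x hx hx_pos
  simp only [llr, hx, ENNReal.toReal_prod]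
  exact Real.log_prod fun i _ => (hx_pos i).ne'

end Density

/-- The product of finitely many Markov kernels: given the inputs, the outputs are independent. -/
def piKernel (κ : ∀ i, Kernel (A i) (B i)) [∀ i, IsMarkovKernel (κ i)] :
    Kernel (∀ i, A i) (∀ i, B i) where
  toFun x := Measure.pi fun i => κ i (x i)
  measurable' := by
    refine Measurable.measure_of_isPiSystem_of_isProbabilityMeasure
      generateFrom_pi.symm isPiSystem_pi ?_
    rintro _ ⟨s, hs, rfl⟩
    simp only [Measure.pi_pi]
    exact Finset.measurable_prod _ fun i _ =>
      ((κ i).measurable_coe (hs i trivial)).comp (measurable_pi_apply i)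

variable (κ : ∀ i, Kernel (A i) (B i)) [∀ i, IsMarkovKernel (κ i)]

lemma piKernel_apply (x : ∀ i, A i) : piKernel κ x = Measure.pi fun i => κ i (x i) := rfl

instance : IsMarkovKernel (piKernel κ) :=
  ⟨fun x => by rw [piKernel_apply]; infer_instance⟩

lemma piKernel_comp_pi (μ : ∀ i, Measure (A i)) [∀ i, IsProbabilityMeasure (μ i)] :
    piKernel κ ∘ₘ Measure.pi μ = Measure.pi fun i => κ i ∘ₘ μ i := by
  refine (Measure.pi_eq fun s hs => ?_).symm
  rw [Measure.bind_apply (MeasurableSet.univ_pi hs) (piKernel κ).aemeasurable]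
  simp_rw [piKernel_apply, Measure.pi_pi, Measure.bind_apply (hs _) (κ _).aemeasurable]
  exact lintegral_fintype_prod_eq_prod μ fun i => (κ i).measurable_coe (hs i)

lemma map_eval_piKernel_comp (μ : Measure (∀ i, A i)) (i : ι) :
    (piKernel κ ∘ₘ μ).map (Function.eval i) = κ i ∘ₘ μ.map (Function.eval i) := by
  have hA : Measurable (Function.eval i : (∀ i, A i) → A i) := measurable_pi_apply i
  have hB : Measurable (Function.eval i : (∀ i, B i) → B i) := measurable_pi_apply i
  ext s hs
  rw [Measure.map_apply hB hs, Measure.bind_apply (hB hs) (piKernel κ).aemeasurable,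
    Measure.bind_apply hs (κ i).aemeasurable, lintegral_map ((κ i).measurable_coe hs) hA]
  refine lintegral_congr fun x => ?_
  rw [piKernel_apply, ← Measure.map_apply hB hs, (measurePreserving_eval _ i).map_eq]

lemma map_pi_compProd_piKernel (μ : ∀ i, Measure (A i)) [∀ i, IsProbabilityMeasure (μ i)] :
    (Measure.pi μ ⊗ₘ piKernel κ).map (fun z i => (z.1 i, z.2 i)) =
      Measure.pi fun i => μ i ⊗ₘ κ i := by
  have hm : Measurable (fun (z : (∀ i, A i) × ∀ i, B i) i => (z.1 i, z.2 i)) := by fun_prop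
  refine (Measure.pi_eq fun s hs => ?_).symm
  rw [Measure.map_apply hm (MeasurableSet.univ_pi hs),
    Measure.compProd_apply (hm (MeasurableSet.univ_pi hs))]
  simp_rw [Measure.compProd_apply (hs _)]
  rw [← lintegral_fintype_prod_eq_prod μ fun i => Kernel.measurable_kernel_prodMk_left (hs i)]
  refine lintegral_congr fun x => ?_
  rw [piKernel_apply, ← Measure.pi_pi]
  congr 1

end Pi

lemma map_pi_pi_swap {ι κ : Type*} [Fintype ι] [Fintype κ] {A : ι → Type*}
    [∀ i, MeasurableSpace (A i)] (μ : ∀ i, κ → Measure (A i))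
    [∀ i t, IsProbabilityMeasure (μ i t)] :
    (Measure.pi fun i => Measure.pi fun t => μ i t).map (fun x t i => x i t) =
      Measure.pi fun t => Measure.pi fun i => μ i t := by
  have hm : Measurable (fun (x : ∀ i, κ → A i) t i => x i t) := by fun_prop
  symm
  -- The inner products are generated by boxes, so it suffices to compare boxes of boxes.
  refine Measure.pi_eq_generateFrom (C := fun _ => Set.pi Set.univ ''
    Set.pi Set.univ fun i => {s : Set (A i) | MeasurableSet s})
    (fun _ => generateFrom_pi) (fun _ => isPiSystem_pi)
    (fun t => ⟨fun _ => Set.univ, fun _ => ⟨fun _ => Set.univ, by simp, by simp⟩,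
      fun _ => measure_lt_top _ _, Set.iUnion_const _⟩) fun s hs => ?_
  choose r hr hrs using hs
  obtain rfl : (fun t => Set.univ.pi (r t)) = s := funext hrs
  have hpre : (fun (x : ∀ i, κ → A i) t i => x i t) ⁻¹' (Set.univ.pi fun t => Set.univ.pi (r t)) =
      Set.univ.pi fun i => Set.univ.pi fun t => r t i := by
    ext x
    simpa only [Set.mem_preimage, Set.mem_univ_pi] using forall_comm
  rw [Measure.map_apply hm (MeasurableSet.univ_pi fun t => MeasurableSet.univ_pi
    fun i => hr t i trivial), hpre]
  simp_rw [Measure.pi_pi]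
  exact Finset.prod_comm

lemma lintegral_uniformOn_univ {W : Type*} [Fintype W] [MeasurableSpace W]
    [MeasurableSingletonClass W] (f : W → ℝ≥0∞) :
    ∫⁻ w, f w ∂(uniformOn Set.univ) = (Fintype.card W : ℝ≥0∞)⁻¹ * ∑ w, f w := by
  rw [lintegral_fintype, Finset.mul_sum]
  exact Finset.sum_congr rfl fun w _ => by
    rw [uniformOn_univ, Measure.count_singleton, one_div, mul_comm]

lemma pi_uniformOn_univ {ι : Type*} [Fintype ι] {W : ι → Type*} [∀ i, Finite (W i)]
    [∀ i, MeasurableSpace (W i)] [∀ i, MeasurableSingletonClass (W i)] :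
    Measure.pi (fun i => uniformOn (Set.univ : Set (W i))) = uniformOn Set.univ := by
  classical
  have (i : ι) := Fintype.ofFinite (W i)
  refine Measure.ext_of_singleton fun w => ?_
  rw [Measure.pi_singleton]
  simp only [uniformOn_univ, Measure.count_singleton, one_div, Fintype.card_pi, Nat.cast_prod]
  exact (ENNReal.prod_inv_distrib fun _ _ _ _ _ => .inr (by simp)).symm

/-! ## Kullback-Leibler divergence -/

section KL

open InformationTheory Real

variable {A B : Type*} [MeasurableSpace A] [MeasurableSpace B]

lemma llr_ae_eq_add {μ ν ρ : Measure A} [SigmaFinite μ] [SigmaFinite ν] [SigmaFinite ρ]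
    (hμν : μ ≪ ν) (hνρ : ν ≪ ρ) : llr μ ρ =ᵐ[μ] fun x => llr μ ν x + llr ν ρ x := by
  have hμρ := hμν.trans hνρ
  filter_upwards [hμρ (Measure.rnDeriv_mul_rnDeriv (κ := ρ) hμν), Measure.rnDeriv_pos hμν,
    hμν (Measure.rnDeriv_pos hνρ), hμν (Measure.rnDeriv_lt_top μ ν),
    hμρ (Measure.rnDeriv_lt_top ν ρ)] with x hx hμν₀ hνρ₀ hμν₁ hνρ₁
  simp only [llr, ← hx, Pi.mul_apply, ENNReal.toReal_mul]
  exact log_mul (ENNReal.toReal_pos hμν₀.ne' hμν₁.ne).ne' (ENNReal.toReal_pos hνρ₀.ne' hνρ₁.ne).ne'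

lemma toReal_klDiv_eq_add_integral_llr {μ ν ρ : Measure A} [IsProbabilityMeasure μ]
    [IsProbabilityMeasure ν] [IsProbabilityMeasure ρ] (hμν : klDiv μ ν ≠ ∞) (hνρ : ν ≪ ρ)
    (hint : Integrable (llr ν ρ) μ) :
    (klDiv μ ρ).toReal = (klDiv μ ν).toReal + ∫ x, llr ν ρ x ∂μ := by
  obtain ⟨hac, hi⟩ := klDiv_ne_top_iff.1 hμν
  rw [toReal_klDiv_of_measure_eq (hac.trans hνρ) (by simp),
    toReal_klDiv_of_measure_eq hac (by simp), integral_congr_ae (llr_ae_eq_add hac hνρ),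
    integral_add hi hint]

lemma klDiv_ne_top_of_integrable_llr {μ ν ρ : Measure A} [IsProbabilityMeasure μ]
    [IsProbabilityMeasure ν] [IsProbabilityMeasure ρ] (hμν : klDiv μ ν ≠ ∞) (hνρ : ν ≪ ρ)
    (hint : Integrable (llr ν ρ) μ) : klDiv μ ρ ≠ ∞ := by
  obtain ⟨hac, hi⟩ := klDiv_ne_top_iff.1 hμν
  exact klDiv_ne_top (hac.trans hνρ) ((hi.add hint).congr (llr_ae_eq_add hac hνρ).symm)

section Pi

variable {ι : Type*} [Fintype ι] {B : ι → Type*} [∀ i, MeasurableSpace (B i)]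

lemma integral_llr_pi {μ : Measure (∀ i, B i)} {m q : ∀ i, Measure (B i)}
    [∀ i, IsProbabilityMeasure (m i)] [∀ i, IsProbabilityMeasure (q i)]
    (hμ : ∀ i, μ.map (Function.eval i) = m i) (hμm : μ ≪ Measure.pi m)
    (hfin : ∀ i, klDiv (m i) (q i) ≠ ∞) :
    Integrable (llr (Measure.pi m) (Measure.pi q)) μ ∧
      ∫ x, llr (Measure.pi m) (Measure.pi q) x ∂μ = ∑ i, (klDiv (m i) (q i)).toReal := by
  have hac (i) := (klDiv_ne_top_iff.1 (hfin i)).1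
  have hllr := hμm.ae_eq (llr_pi hac)
  have hm (i) : MeasurePreserving (Function.eval i) μ (m i) := ⟨measurable_pi_apply i, hμ i⟩
  have hint (i) : Integrable (fun x => llr (m i) (q i) (x i)) μ :=
    (hm i).integrable_comp_of_integrable (klDiv_ne_top_iff.1 (hfin i)).2
  refine ⟨(integrable_finsetSum Finset.univ fun i _ => hint i).congr hllr.symm, ?_⟩
  rw [integral_congr_ae hllr, integral_finsetSum _ fun i _ => hint i]
  refine Finset.sum_congr rfl fun i _ => ?_
  rw [toReal_klDiv_of_measure_eq (hac i) (by simp), ← hμ i,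
    integral_map (hm i).aemeasurable (measurable_llr _ _).aestronglyMeasurable]

lemma klDiv_pi_le_add_sum (μ : Measure (∀ i, B i)) [IsProbabilityMeasure μ]
    (q : ∀ i, Measure (B i)) [∀ i, IsProbabilityMeasure (q i)] :
    klDiv μ (Measure.pi q) ≤ klDiv μ (Measure.pi fun i => μ.map (Function.eval i)) +
      ∑ i, klDiv (μ.map (Function.eval i)) (q i) := by
  have (i : ι) : IsProbabilityMeasure (μ.map (Function.eval i)) :=
    Measure.isProbabilityMeasure_map (measurable_pi_apply i).aemeasurable
  by_cases hjoint : klDiv μ (Measure.pi fun i => μ.map (Function.eval i)) = ∞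
  · simp [hjoint]
  by_cases hsum : ∑ i, klDiv (μ.map (Function.eval i)) (q i) = ∞
  · simp [hsum]
  have hfin (i) : klDiv (μ.map (Function.eval i)) (q i) ≠ ∞ := fun h =>
    hsum (ENNReal.sum_eq_top.2 ⟨i, Finset.mem_univ i, h⟩)
  obtain ⟨hint, heq⟩ := integral_llr_pi (fun _ => rfl) (klDiv_ne_top_iff.1 hjoint).1 hfin
  have hac := absolutelyContinuous_pi fun i => (klDiv_ne_top_iff.1 (hfin i)).1
  rw [← ENNReal.toReal_le_toReal (klDiv_ne_top_of_integrable_llr hjoint hac hint)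
    (ENNReal.add_ne_top.2 ⟨hjoint, hsum⟩), ENNReal.toReal_add hjoint hsum,
    ENNReal.toReal_sum fun i _ => hfin i, ← heq]
  exact (toReal_klDiv_eq_add_integral_llr hjoint hac hint).le

lemma klDiv_pi_pi_le_sum (m q : ∀ i, Measure (B i)) [∀ i, IsProbabilityMeasure (m i)]
    [∀ i, IsProbabilityMeasure (q i)] :
    klDiv (Measure.pi m) (Measure.pi q) ≤ ∑ i, klDiv (m i) (q i) := by
  refine (klDiv_pi_le_add_sum (Measure.pi m) q).trans ?_
  simp_rw [(measurePreserving_eval m _).map_eq]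
  simp

end Pi

section Prod

variable {m u : Measure A} [IsProbabilityMeasure m] [IsProbabilityMeasure u]
  {q v : Measure B} [IsProbabilityMeasure q] [IsProbabilityMeasure v]

lemma rnDeriv_prod (hmu : m ≪ u) (hqv : q ≪ v) :
    (m.prod q).rnDeriv (u.prod v) =ᵐ[u.prod v] fun z => m.rnDeriv u z.1 * q.rnDeriv v z.2 := by
  have hm := Measure.withDensity_rnDeriv_eq m u hmu
  have hq := Measure.withDensity_rnDeriv_eq q v hqv
  have : SFinite (u.withDensity (m.rnDeriv u)) := by rw [hm]; infer_instance
  have : SFinite (v.withDensity (q.rnDeriv v)) := by rw [hq]; infer_instance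
  have hprod : m.prod q =
      (u.prod v).withDensity fun z => m.rnDeriv u z.1 * q.rnDeriv v z.2 := by
    rw [← prod_withDensity (Measure.measurable_rnDeriv _ _) (Measure.measurable_rnDeriv _ _),
      hm, hq]
  conv_lhs => rw [hprod]
  exact Measure.rnDeriv_withDensity _ (by fun_prop)

variable {P : Measure (A × B)} [IsProbabilityMeasure P]

lemma ae_rnDeriv_fst_mul_rnDeriv_snd_ne_zero (hu : P.fst ≪ u) (hv : P.snd ≪ v) :
    ∀ᵐ z ∂P, P.fst.rnDeriv u z.1 * P.snd.rnDeriv v z.2 ≠ 0 := by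
  filter_upwards [ae_of_ae_map measurable_fst.aemeasurable (Measure.rnDeriv_pos hu),
    ae_of_ae_map measurable_snd.aemeasurable (Measure.rnDeriv_pos hv)] with z hz_fst hz_snd
  exact mul_ne_zero hz_fst.ne' hz_snd.ne'

lemma llr_prod_fst_snd (hu : P.fst ≪ u) (hv : P.snd ≪ v) (hP : P ≪ u.prod v) :
    llr (P.fst.prod P.snd) (u.prod v) =ᵐ[P] fun z => llr P.fst u z.1 + llr P.snd v z.2 := by
  filter_upwards [hP (rnDeriv_prod hu hv), ae_rnDeriv_fst_mul_rnDeriv_snd_ne_zero hu hv,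
    ae_of_ae_map measurable_fst.aemeasurable (hu (Measure.rnDeriv_lt_top P.fst u)),
    ae_of_ae_map measurable_snd.aemeasurable (hv (Measure.rnDeriv_lt_top P.snd v))]
    with z hz hne hfst hsnd
  obtain ⟨hfst₀, hsnd₀⟩ := mul_ne_zero_iff.1 hne
  simp only [llr, hz, ENNReal.toReal_mul]
  exact log_mul (ENNReal.toReal_ne_zero.2 ⟨hfst₀, hfst.ne⟩) (ENNReal.toReal_ne_zero.2
    ⟨hsnd₀, hsnd.ne⟩)

lemma absolutelyContinuous_prod_fst_snd (hP : P ≪ u.prod v) : P ≪ P.fst.prod P.snd := by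
  have hu : P.fst ≪ u := by
    rw [← Measure.fst_prod (μ := u) (ν := v)]
    exact hP.map measurable_fst
  have hv : P.snd ≪ v := by
    rw [← Measure.snd_prod (μ := u) (ν := v)]
    exact hP.map measurable_snd
  refine Measure.AbsolutelyContinuous.mk fun s hs hs_null => ?_
  rw [← Measure.setLIntegral_rnDeriv (hu.prod hv),
    setLIntegral_eq_zero_iff hs (Measure.measurable_rnDeriv _ _)] at hs_null
  refine measure_eq_zero_iff_ae_notMem.2 ?_
  filter_upwards [hP hs_null, hP (rnDeriv_prod hu hv),
    ae_rnDeriv_fst_mul_rnDeriv_snd_ne_zero hu hv] with z hzero hz hne hzs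
  exact hne (hz ▸ hzero hzs)

lemma integral_llr_prod_fst_snd (hP : P ≪ u.prod v) (hu : klDiv P.fst u ≠ ∞)
    (hv : klDiv P.snd v ≠ ∞) :
    Integrable (llr (P.fst.prod P.snd) (u.prod v)) P ∧
      ∫ z, llr (P.fst.prod P.snd) (u.prod v) z ∂P =
        (klDiv P.fst u).toReal + (klDiv P.snd v).toReal := by
  obtain ⟨hacu, hintu⟩ := klDiv_ne_top_iff.1 hu
  obtain ⟨hacv, hintv⟩ := klDiv_ne_top_iff.1 hv
  have hllr := llr_prod_fst_snd hacu hacv hP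
  have hfst : Integrable (fun z => llr P.fst u z.1) P := hintu.comp_measurable measurable_fst
  have hsnd : Integrable (fun z => llr P.snd v z.2) P := hintv.comp_measurable measurable_snd
  refine ⟨(hfst.add hsnd).congr hllr.symm, ?_⟩
  rw [integral_congr_ae hllr, integral_add hfst hsnd, toReal_klDiv_of_measure_eq hacu (by simp),
    toReal_klDiv_of_measure_eq hacv (by simp)]
  congr 1
  · exact (integral_map measurable_fst.aemeasurable hintu.aestronglyMeasurable).symm
  · exact (integral_map measurable_snd.aemeasurable hintv.aestronglyMeasurable).symm

lemma klDiv_fst_le_klDiv_prod : klDiv P.fst u ≤ klDiv P (u.prod v) :=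
  (congrArg (klDiv P.fst) Measure.fst_prod).symm.trans_le (klDiv_map_le P _ measurable_fst)

lemma klDiv_snd_le_klDiv_prod : klDiv P.snd v ≤ klDiv P (u.prod v) :=
  (congrArg (klDiv P.snd) Measure.snd_prod).symm.trans_le (klDiv_map_le P _ measurable_snd)

lemma mutualInformation_ne_top_of_klDiv_prod_ne_top (hP : klDiv P (u.prod v) ≠ ∞) :
    mutualInformation P ≠ ∞ := by
  obtain ⟨hac, hint⟩ := klDiv_ne_top_iff.1 hP
  have hu : klDiv P.fst u ≠ ∞ := ne_top_of_le_ne_top hP klDiv_fst_le_klDiv_prod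
  have hv : klDiv P.snd v ≠ ∞ := ne_top_of_le_ne_top hP klDiv_snd_le_klDiv_prod
  have hprod := absolutelyContinuous_prod_fst_snd hac
  have hmarginal := (integral_llr_prod_fst_snd hac hu hv).1
  have hchain := llr_ae_eq_add hprod
    ((klDiv_ne_top_iff.1 hu).1.prod (klDiv_ne_top_iff.1 hv).1)
  refine klDiv_ne_top hprod ((hint.sub hmarginal).congr ?_)
  filter_upwards [hchain] with z hz
  rw [Pi.sub_apply, hz, add_sub_cancel_right]

variable (u v P) in
/-- The golden formula: the product of the marginals minimizes the divergence to product laws. -/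
theorem klDiv_prod_eq_mutualInformation_add :
    klDiv P (u.prod v) = mutualInformation P + (klDiv P.fst u + klDiv P.snd v) := by
  by_cases hP : klDiv P (u.prod v) = ∞
  · by_contra hne
    rw [hP] at hne
    obtain ⟨hI, hu, hv⟩ : mutualInformation P ≠ ∞ ∧ klDiv P.fst u ≠ ∞ ∧ klDiv P.snd v ≠ ∞ := by
      simpa only [ENNReal.add_ne_top] using Ne.symm hne
    have hac := (klDiv_ne_top_iff.1 hu).1.prod (klDiv_ne_top_iff.1 hv).1
    have hint := (integral_llr_prod_fst_snd ((klDiv_ne_top_iff.1 hI).1.trans hac) hu hv).1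
    exact klDiv_ne_top_of_integrable_llr hI hac hint hP
  · have hu : klDiv P.fst u ≠ ∞ := ne_top_of_le_ne_top hP klDiv_fst_le_klDiv_prod
    have hv : klDiv P.snd v ≠ ∞ := ne_top_of_le_ne_top hP klDiv_snd_le_klDiv_prod
    have hI := mutualInformation_ne_top_of_klDiv_prod_ne_top hP
    obtain ⟨hint, heq⟩ := integral_llr_prod_fst_snd (klDiv_ne_top_iff.1 hP).1 hu hv
    rw [← ENNReal.toReal_eq_toReal_iff' hP (by simp [hI, hu, hv]),
      ENNReal.toReal_add hI (by simp [hu, hv]), ENNReal.toReal_add hu hv, ← heq]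
    exact toReal_klDiv_eq_add_integral_llr hI
      ((klDiv_ne_top_iff.1 hu).1.prod (klDiv_ne_top_iff.1 hv).1) hint

end Prod

section CompProd

variable (u : Measure A) [IsProbabilityMeasure u]

lemma rnDeriv_compProd_right [MeasurableSpace.CountableOrCountablyGenerated A B]
    {κ η : Kernel A B} [IsMarkovKernel κ] [IsMarkovKernel η] (hac : ∀ᵐ x ∂u, κ x ≪ η x) :
    (u ⊗ₘ κ).rnDeriv (u ⊗ₘ η) =ᵐ[u ⊗ₘ η] fun z => κ.rnDeriv η z.1 z.2 := by
  have hden : u ⊗ₘ κ = (u ⊗ₘ η).withDensity fun z => κ.rnDeriv η z.1 z.2 := by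
    rw [← Measure.compProd_withDensity (Kernel.measurable_rnDeriv κ η)]
    refine Measure.compProd_congr ?_
    filter_upwards [hac] with x hx using (Kernel.withDensity_rnDeriv_eq hx).symm
  conv_lhs => rw [hden]
  exact Measure.rnDeriv_withDensity _ (Kernel.measurable_rnDeriv κ η)

lemma klDiv_compProd_eq_lintegral [MeasurableSpace.CountableOrCountablyGenerated A B]
    (κ η : Kernel A B) [IsMarkovKernel κ] [IsMarkovKernel η] :
    klDiv (u ⊗ₘ κ) (u ⊗ₘ η) = ∫⁻ x, klDiv (κ x) (η x) ∂u := by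
  by_cases hac : ∀ᵐ x ∂u, κ x ≪ η x
  · have hr : (fun z => ENNReal.ofReal (klFun ((u ⊗ₘ κ).rnDeriv (u ⊗ₘ η) z).toReal))
        =ᵐ[u ⊗ₘ η] fun z => ENNReal.ofReal (klFun (κ.rnDeriv η z.1 z.2).toReal) := by
      filter_upwards [rnDeriv_compProd_right u hac] with z hz
      rw [hz]
    have hmeas : Measurable fun z : A × B =>
        ENNReal.ofReal (klFun (κ.rnDeriv η z.1 z.2).toReal) := by
      fun_prop
    rw [klDiv_eq_lintegral_klFun_of_ac (Measure.absolutelyContinuous_compProd_right_iff.2 hac),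
      lintegral_congr_ae hr, Measure.lintegral_compProd hmeas]
    refine lintegral_congr_ae ?_
    filter_upwards [hac] with x hx
    rw [klDiv_eq_lintegral_klFun_of_ac hx]
    refine lintegral_congr_ae ?_
    filter_upwards [Kernel.rnDeriv_eq_rnDeriv_measure (κ := κ) (η := η) (a := x)] with y hy
    rw [hy]
  · rw [klDiv_of_not_ac fun h => hac (Measure.absolutelyContinuous_compProd_right_iff.1 h)]
    have hS : MeasurableSet {x | ¬ κ x ≪ η x} :=
      (Kernel.measurableSet_absolutelyContinuous κ η).compl
    refine (top_unique ?_).symm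
    calc ∞ = ∫⁻ _ in {x | ¬ κ x ≪ η x}, ∞ ∂u := by
          rw [setLIntegral_const, ENNReal.top_mul fun h => hac (ae_iff.2 h)]
      _ = ∫⁻ x in {x | ¬ κ x ≪ η x}, klDiv (κ x) (η x) ∂u :=
          setLIntegral_congr_fun hS fun _ hx => (klDiv_of_not_ac hx).symm
      _ ≤ ∫⁻ x, klDiv (κ x) (η x) ∂u := setLIntegral_le_lintegral _ _

lemma klDiv_compProd_pi_le_add_sum [Countable A] [MeasurableSingletonClass A] {ι : Type*}
    [Fintype ι] {B : ι → Type*} [∀ i, MeasurableSpace (B i)] (K : Kernel A (∀ i, B i))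
    [IsMarkovKernel K] (q : ∀ i, Measure (B i)) [∀ i, IsProbabilityMeasure (q i)] {c : ℝ≥0∞}
    (hc : ∀ a, klDiv (K a) (Measure.pi fun i => (K a).map (Function.eval i)) ≤ c) :
    klDiv (u ⊗ₘ K) (u.prod (Measure.pi q)) ≤
      c + ∑ i, klDiv (u ⊗ₘ K.map (Function.eval i)) (u.prod (q i)) := by
  have (i : ι) : IsMarkovKernel (K.map (Function.eval i)) :=
    Kernel.IsMarkovKernel.map _ (measurable_pi_apply i)
  simp_rw [← Measure.compProd_const, klDiv_compProd_eq_lintegral, Kernel.const_apply,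
    Kernel.map_apply _ (measurable_pi_apply _)]
  calc ∫⁻ a, klDiv (K a) (Measure.pi q) ∂u
      ≤ ∫⁻ a, (c + ∑ i, klDiv ((K a).map (Function.eval i)) (q i)) ∂u :=
        lintegral_mono fun a => (klDiv_pi_le_add_sum (K a) q).trans (by gcongr; exact hc a)
    _ = c + ∑ i, ∫⁻ a, klDiv ((K a).map (Function.eval i)) (q i) ∂u := by
        rw [lintegral_add_left measurable_const,
          lintegral_finsetSum _ fun _ _ => measurable_of_countable _]
        simp

lemma klDiv_compProd_prod_eq_add (κ : Kernel A B) [IsMarkovKernel κ] (q : Measure B)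
    [IsProbabilityMeasure q] :
    klDiv (u ⊗ₘ κ) (u.prod q) = mutualInformation (u ⊗ₘ κ) + klDiv (κ ∘ₘ u) q := by
  rw [klDiv_prod_eq_mutualInformation_add u q (u ⊗ₘ κ), Measure.fst_compProd,
    Measure.snd_compProd, klDiv_self, zero_add]

lemma map_compProd_comap {X : Type*} [MeasurableSpace X] {φ : A → X} (hφ : Measurable φ)
    (κ : Kernel X B) [IsMarkovKernel κ] :
    (u ⊗ₘ κ.comap φ hφ).map (Prod.map φ id) = u.map φ ⊗ₘ κ := by
  have hΦ : Measurable (Prod.map φ id : A × B → X × B) := hφ.prodMap measurable_id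
  ext s hs
  rw [Measure.map_apply hΦ hs, Measure.compProd_apply (hΦ hs), Measure.compProd_apply hs,
    lintegral_map (Kernel.measurable_kernel_prodMk_left hs) hφ]
  rfl

lemma compProd_comap_eq_withDensity {X : Type*} [MeasurableSpace X] {φ : A → X}
    (hφ : Measurable φ) {κ η : Kernel X B} [IsMarkovKernel κ] [IsMarkovKernel η]
    {r : X × B → ℝ≥0∞} (hr : Measurable r)
    (hden : u.map φ ⊗ₘ κ = (u.map φ ⊗ₘ η).withDensity r) :
    u ⊗ₘ κ.comap φ hφ = (u ⊗ₘ η.comap φ hφ).withDensity (r ∘ Prod.map φ id) := by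
  have := Measure.isProbabilityMeasure_map (μ := u) hφ.aemeasurable
  have hrφ : Measurable (r ∘ (Prod.map φ id : A × B → X × B)) :=
    hr.comp (hφ.prodMap measurable_id)
  have hsection {t : Set B} (ht : MeasurableSet t) :
      ∀ᵐ a ∂u, κ (φ a) t = ∫⁻ b in t, r (φ a, b) ∂η (φ a) := by
    refine ae_of_ae_map hφ.aemeasurable (p := fun x => κ x t = ∫⁻ b in t, r (x, b) ∂η x) ?_
    refine ae_eq_of_forall_setLIntegral_eq_of_sigmaFinite (κ.measurable_coe ht)
      (Measurable.setLIntegral_kernel_prod_right (f := fun x b => r (x, b)) hr ht) fun s hs _ => ?_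
    rw [← Measure.compProd_apply_prod hs ht, hden, withDensity_apply _ (hs.prod ht),
      Measure.setLIntegral_compProd hr hs ht]
  refine Measure.ext_prod fun {s t} hs ht => ?_
  rw [withDensity_apply _ (hs.prod ht), Measure.setLIntegral_compProd hrφ hs ht,
    Measure.compProd_apply_prod hs ht]
  exact lintegral_congr_ae (ae_restrict_of_ae (hsection ht))

lemma klDiv_compProd_comap_le {X : Type*} [MeasurableSpace X] {φ : A → X} (hφ : Measurable φ)
    (κ η : Kernel X B) [IsMarkovKernel κ] [IsMarkovKernel η] :
    klDiv (u ⊗ₘ κ.comap φ hφ) (u ⊗ₘ η.comap φ hφ) ≤ klDiv (u.map φ ⊗ₘ κ) (u.map φ ⊗ₘ η) := by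
  have := Measure.isProbabilityMeasure_map (μ := u) hφ.aemeasurable
  by_cases hac : u.map φ ⊗ₘ κ ≪ u.map φ ⊗ₘ η
  swap
  · simp [klDiv_of_not_ac hac]
  set r := (u.map φ ⊗ₘ κ).rnDeriv (u.map φ ⊗ₘ η)
  have hr : Measurable r := Measure.measurable_rnDeriv _ _
  have hΦ : Measurable (Prod.map φ id : A × B → X × B) := hφ.prodMap measurable_id
  have hdens := compProd_comap_eq_withDensity u hφ hr (Measure.withDensity_rnDeriv_eq _ _ hac).symm
  have hrn : (u ⊗ₘ κ.comap φ hφ).rnDeriv (u ⊗ₘ η.comap φ hφ) =ᵐ[u ⊗ₘ η.comap φ hφ]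
      r ∘ Prod.map φ id := by
    rw [hdens]
    exact Measure.rnDeriv_withDensity _ (hr.comp hΦ)
  have hmeas : Measurable fun z => ENNReal.ofReal (klFun (r z).toReal) := by fun_prop
  refine Eq.le ?_
  calc klDiv (u ⊗ₘ κ.comap φ hφ) (u ⊗ₘ η.comap φ hφ)
      = ∫⁻ z, ENNReal.ofReal (klFun (r (Prod.map φ id z)).toReal) ∂(u ⊗ₘ η.comap φ hφ) := by
        rw [klDiv_eq_lintegral_klFun_of_ac (hdens ▸ withDensity_absolutelyContinuous _ _)]
        refine lintegral_congr_ae ?_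
        filter_upwards [hrn] with z hz
        rw [hz, Function.comp_apply]
    _ = klDiv (u.map φ ⊗ₘ κ) (u.map φ ⊗ₘ η) := by
        rw [klDiv_eq_lintegral_klFun_of_ac hac, ← lintegral_map hmeas hΦ, map_compProd_comap]

end CompProd

section Fano

lemma measureReal_mul_log_div_le_setIntegral_klFun {μ ν : Measure A} [IsFiniteMeasure μ]
    [IsFiniteMeasure ν] (hac : μ ≪ ν)
    (hint : Integrable (fun x => klFun (μ.rnDeriv ν x).toReal) ν) (E : Set A) :
    μ.real E * log (μ.real E / ν.real E) + ν.real E - μ.real E ≤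
      ∫ x in E, klFun (μ.rnDeriv ν x).toReal ∂ν := by
  by_cases hE : ν E = 0
  · simp [measureReal_def, hE, hac hE, Measure.restrict_eq_zero.2 hE]
  have hE' : ν.real E ≠ 0 := (measureReal_ne_zero_iff).2 hE
  have hjensen := convexOn_klFun.map_set_average_le continuous_klFun.continuousOn isClosed_Ici
    hE (measure_ne_top ν E) (ae_of_all _ fun x => ENNReal.toReal_nonneg)
    Measure.integrable_toReal_rnDeriv.integrableOn hint.integrableOn
  rw [setAverage_eq, setAverage_eq, Measure.setIntegral_toReal_rnDeriv hac, smul_eq_mul,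
    smul_eq_mul, ← div_eq_inv_mul, ← div_eq_inv_mul, le_div_iff₀ (by positivity), klFun_apply]
    at hjensen
  refine le_trans (le_of_eq ?_) hjensen
  field_simp

lemma measureReal_mul_log_div_le_toReal_klDiv {μ ν : Measure A} [IsProbabilityMeasure μ]
    [IsProbabilityMeasure ν] (hfin : klDiv μ ν ≠ ∞) {E : Set A} (hE : MeasurableSet E) :
    μ.real E * log (μ.real E / ν.real E) + μ.real Eᶜ * log (μ.real Eᶜ / ν.real Eᶜ) ≤
      (klDiv μ ν).toReal := by
  obtain ⟨hac, hllr⟩ := klDiv_ne_top_iff.1 hfin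
  have hint := (integrable_klFun_rnDeriv_iff hac).2 hllr
  rw [toReal_klDiv_eq_integral_klFun hac, ← integral_add_compl hE hint]
  have hμ := probReal_add_probReal_compl (μ := μ) hE
  have hν := probReal_add_probReal_compl (μ := ν) hE
  linarith [measureReal_mul_log_div_le_setIntegral_klFun hac hint E,
    measureReal_mul_log_div_le_setIntegral_klFun hac hint Eᶜ]

lemma mul_log_le_mul_log_div {p q : ℝ} (hp : 0 ≤ p) (hp' : p ≤ 1) (hq : 0 ≤ q) (hq' : q ≤ 1) :
    p * log p ≤ p * log (p / q) := by
  rcases hp.eq_or_lt with rfl | hp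
  · simp
  rcases hq.eq_or_lt with rfl | hq
  · simpa using mul_nonpos_of_nonneg_of_nonpos hp.le (log_nonpos hp.le hp')
  · gcongr
    exact (le_div_iff₀ hq).2 (mul_le_of_le_one_right hp.le hq')

instance {W : Type*} [MeasurableSpace W] [MeasurableSingletonClass W] [Finite W] [Nonempty W] :
    IsProbabilityMeasure (uniformOn (Set.univ : Set W)) :=
  isProbabilityMeasure_uniformOn Set.finite_univ Set.univ_nonempty

variable {W : Type*} [Fintype W] [MeasurableSpace W] [MeasurableSingletonClass W]

lemma uniformOn_univ_prod_eq_inv_card (q : Measure B) [IsProbabilityMeasure q] {dec : B → W}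
    (hdec : Measurable dec) :
    ((uniformOn Set.univ).prod q) {z | dec z.2 = z.1} = (Fintype.card W : ℝ≥0∞)⁻¹ := by
  have hE : MeasurableSet {z : W × B | dec z.2 = z.1} :=
    measurableSet_eq_fun (hdec.comp measurable_snd) measurable_fst
  have hfibers : ∑ w, q (Prod.mk w ⁻¹' {z | dec z.2 = z.1}) = 1 := by
    refine (sum_measure_preimage_singleton Finset.univ fun w _ =>
      hdec (measurableSet_singleton w)).trans ?_
    simp
  rw [Measure.prod_apply hE, lintegral_uniformOn_univ, hfibers, mul_one]

/-- Fano's inequality. -/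
lemma one_sub_mul_log_card_le_toReal_mutualInformation_add_binEntropy [Nonempty W]
    {P : Measure (W × B)} (hP : P.fst = uniformOn Set.univ) (hfin : mutualInformation P ≠ ∞)
    {dec : B → W} (hdec : Measurable dec) :
    (1 - P.real {z | dec z.2 ≠ z.1}) * log (Fintype.card W) ≤
      (mutualInformation P).toReal + binEntropy (P.real {z | dec z.2 ≠ z.1}) := by
  have : IsProbabilityMeasure P := ⟨by rw [← Measure.fst_univ, hP, measure_univ]⟩
  have hE : MeasurableSet {z : W × B | dec z.2 = z.1} :=
    measurableSet_eq_fun (hdec.comp measurable_snd) measurable_fst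
  have hlogsum : _ ≤ (mutualInformation P).toReal := measureReal_mul_log_div_le_toReal_klDiv hfin hE
  rw [hP] at hlogsum
  have hQ : ((uniformOn Set.univ).prod P.snd).real {z | dec z.2 = z.1} =
      (Fintype.card W : ℝ)⁻¹ := by
    simp [measureReal_def, uniformOn_univ_prod_eq_inv_card P.snd hdec]
  set p := P.real {z | dec z.2 ≠ z.1} with hp
  have hcompl : {z : W × B | dec z.2 = z.1}ᶜ = {z | dec z.2 ≠ z.1} := rfl
  have hcorrect : P.real {z | dec z.2 = z.1} = 1 - p := by
    rw [hp, ← hcompl, probReal_compl_eq_one_sub hE, sub_sub_cancel]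
  rw [hcompl, ← hp, hcorrect, hQ, div_inv_eq_mul] at hlogsum
  have hlogcard : (1 - p) * log ((1 - p) * Fintype.card W) =
      (1 - p) * log (1 - p) + (1 - p) * log (Fintype.card W) := by
    rcases eq_or_ne (1 - p) 0 with h | h
    · simp [h]
    · rw [log_mul h (by simp), mul_add]
  have herror := mul_log_le_mul_log_div (p := p) measureReal_nonneg measureReal_le_one
    (measureReal_nonneg (μ := (uniformOn Set.univ).prod P.snd) (s := {z | dec z.2 ≠ z.1}))
    measureReal_le_one
  rw [binEntropy, log_inv, log_inv]
  linarith

end Fano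

lemma mutualInformation_compProd (p : Measure A) [IsProbabilityMeasure p] (κ : Kernel A B)
    [IsMarkovKernel κ] :
    mutualInformation (p ⊗ₘ κ) = klDiv (p ⊗ₘ κ) (p.prod (κ ∘ₘ p)) := by
  rw [mutualInformation, Measure.fst_compProd, Measure.snd_compProd]

end KL

namespace ManyToOneChannel

variable {n : ℕ} {X Y : Fin (n + 1) → Type*} {V : Type*}
  [∀ i, MeasurableSpace (X i)] [∀ i, MeasurableSpace (Y i)] [MeasurableSpace V]
  (C : ManyToOneChannel n X Y V)

/-! ## Single-user links -/

instance : IsMarkovKernel C.interference := by unfold interference; infer_instance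

lemma measurable_f_right (x : X 0) : Measurable fun v => C.f (x, v) :=
  C.measurable_f.comp measurable_prodMk_left

lemma measurable_assemble_right (x : ∀ i, X i) : Measurable fun q => C.assemble (x, q) :=
  C.measurable_assemble.comp measurable_prodMk_left

lemma channel_apply (x : ∀ i, X i) :
    C.channel x = (C.law fun i => x i.succ).map fun q => C.assemble (x, q) := by
  rw [channel, Kernel.map_apply _ C.measurable_assemble, Kernel.prod_apply, Kernel.id_apply,
    Measure.dirac_prod, Measure.map_map C.measurable_assemble measurable_prodMk_left,
    Kernel.comap_apply]
  rfl

lemma map_eval_succ_channel (x : ∀ i, X i) (i : Fin n) :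
    (C.channel x).map (Function.eval i.succ) = C.direct i (x i.succ) := by
  rw [channel_apply, Measure.map_map (g := Function.eval _) (measurable_pi_apply _)
    (C.measurable_assemble_right x), ← C.law_output (fun i => x i.succ) i]
  rfl

lemma map_eval_zero_channel (x : ∀ i, X i) :
    (C.channel x).map (Function.eval 0) =
      (C.interference fun i => x i.succ).map fun v => C.f (x 0, v) := by
  rw [channel_apply, Measure.map_map (g := Function.eval _) (measurable_pi_apply _)
    (C.measurable_assemble_right x), interference, Kernel.fst_apply,
    Measure.map_map (C.measurable_f_right _) measurable_fst]
  rfl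

/-- The channel from the input to the output of user `0` for interference of law `v`. -/
def linkZero (v : Measure V) : Kernel (X 0) (Y 0) := (Kernel.id ×ₖ Kernel.const _ v).map C.f

instance (v : Measure V) [IsProbabilityMeasure v] : IsMarkovKernel (C.linkZero v) :=
  Kernel.IsMarkovKernel.map _ C.measurable_f

lemma linkZero_apply (v : Measure V) [IsProbabilityMeasure v] (x : X 0) :
    C.linkZero v x = v.map fun v => C.f (x, v) := by
  rw [linkZero, Kernel.map_apply _ C.measurable_f, Kernel.prod_apply, Kernel.id_apply,
    Measure.dirac_prod, Measure.map_map C.measurable_f measurable_prodMk_left, Kernel.const_apply]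
  rfl

variable (p : ∀ i, ProbabilityMeasure (X i))

/-- The law of the interference when the inputs are independent with laws `p`. -/
def interferenceLaw : Measure V :=
  C.interference ∘ₘ Measure.pi fun j : Fin n => (p j.succ : Measure (X j.succ))

instance : IsProbabilityMeasure (C.interferenceLaw p) := by
  unfold interferenceLaw; infer_instance

/-- The law of the output of user `i.succ` when the inputs are independent with laws `p`. -/
def outputLaw (i : Fin n) : Measure (Y i.succ) := C.direct i ∘ₘ (p i.succ : Measure (X i.succ))

instance (i : Fin n) : IsProbabilityMeasure (C.outputLaw p i) := by
  unfold outputLaw; infer_instance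

lemma userLaw_eq_map_compProd_map_eval (i : Fin (n + 1)) :
    C.userLaw p i = ((Measure.pi fun j => (p j : Measure (X j))) ⊗ₘ
      C.channel.map (Function.eval i)).map (Prod.map (Function.eval i) id) := by
  have heval : Measurable (Function.eval i : (∀ i, Y i) → Y i) := measurable_pi_apply i
  rw [userLaw, Measure.compProd_map heval, Measure.map_map (by fun_prop) (by fun_prop)]
  rfl

instance (i : Fin (n + 1)) : IsProbabilityMeasure (C.userLaw p i) :=
  Measure.isProbabilityMeasure_map (by fun_prop)

lemma fst_userLaw (i : Fin (n + 1)) : (C.userLaw p i).fst = p i := by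
  rw [userLaw, Measure.fst_map_prodMk (by fun_prop)]
  change (_ : Measure _).map (Function.eval i ∘ Prod.fst) = _
  rw [← Measure.map_map (measurable_pi_apply i) measurable_fst, ← Measure.fst,
    Measure.fst_compProd, (measurePreserving_eval _ i).map_eq]

lemma userLaw_succ (i : Fin n) :
    C.userLaw p i.succ = (p i.succ : Measure (X i.succ)) ⊗ₘ C.direct i := by
  have heval : Measurable (Function.eval i.succ : (∀ i, X i) → X i.succ) := measurable_pi_apply _
  have hlink : C.channel.map (Function.eval i.succ) = (C.direct i).comap _ heval := by
    ext1 x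
    rw [Kernel.map_apply _ (measurable_pi_apply _), map_eval_succ_channel, Kernel.comap_apply]
  rw [userLaw_eq_map_compProd_map_eval, hlink, map_compProd_comap,
    (measurePreserving_eval _ i.succ).map_eq]

lemma measurable_interference_prodMk_left {s : Set (X 0 × Y 0)} (hs : MeasurableSet s) :
    Measurable fun z : X 0 × (∀ j : Fin n, X j.succ) =>
      C.interference z.2 {v | (z.1, C.f (z.1, v)) ∈ s} := by
  have hf := C.measurable_f
  exact Kernel.measurable_kernel_prodMk_left
    (κ := C.interference.comap Prod.snd (measurable_snd (α := X 0)))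
    (t := {w | (w.1.1, C.f (w.1.1, w.2)) ∈ s}) (hs.preimage (by fun_prop))

lemma userLaw_zero :
    C.userLaw p 0 = (p 0 : Measure (X 0)) ⊗ₘ C.linkZero (C.interferenceLaw p) := by
  ext s hs
  have hpair : Measurable fun z : (∀ i, X i) × (∀ i, Y i) => (z.1 0, z.2 0) := by fun_prop
  have hint := C.measurable_interference_prodMk_left hs
  have hsection (x : X 0) : MeasurableSet {y | (x, y) ∈ s} := hs.preimage measurable_prodMk_left
  have hsplit : (Measure.pi fun j => (p j : Measure (X j))).map
      (fun x => (x 0, fun j : Fin n => x j.succ)) =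
      (p 0 : Measure (X 0)).prod (Measure.pi fun j : Fin n => (p j.succ : Measure (X j.succ))) :=
    (measurePreserving_piFinSuccAbove (fun j => (p j : Measure (X j))) 0).map_eq
  calc C.userLaw p 0 s
      = ∫⁻ x, C.interference (fun j => x j.succ) {v | (x 0, C.f (x 0, v)) ∈ s}
          ∂(Measure.pi fun j => (p j : Measure (X j))) := by
        rw [userLaw, Measure.map_apply hpair hs, Measure.compProd_apply (hpair hs)]
        refine lintegral_congr fun x => ?_
        have hzero := congrArg (· {y | (x 0, y) ∈ s}) (C.map_eval_zero_channel x)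
        rwa [Measure.map_apply (measurable_pi_apply 0) (hsection _),
          Measure.map_apply (C.measurable_f_right _) (hsection _)] at hzero
    _ = ∫⁻ x, ∫⁻ x', C.interference x' {v | (x, C.f (x, v)) ∈ s}
          ∂(Measure.pi fun j : Fin n => (p j.succ : Measure (X j.succ)))
          ∂(p 0 : Measure (X 0)) := by
        rw [← lintegral_prod _ hint.aemeasurable, ← hsplit, lintegral_map hint (by fun_prop)]
    _ = ∫⁻ x, C.interferenceLaw p {v | (x, C.f (x, v)) ∈ s} ∂(p 0 : Measure (X 0)) :=
        lintegral_congr fun x => (Measure.bind_apply (C.measurable_f_right x (hsection x))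
          C.interference.aemeasurable).symm
    _ = ((p 0 : Measure (X 0)) ⊗ₘ C.linkZero (C.interferenceLaw p)) s := by
        rw [Measure.compProd_apply hs]
        refine lintegral_congr fun x => ?_
        rw [linkZero_apply]
        exact (Measure.map_apply (C.measurable_f_right x) (hsection x)).symm

lemma interferenceLaw_eq_comp_pi_outputLaw {D : Kernel (∀ i : Fin n, Y i.succ) V}
    (hD : ∀ x : ∀ i : Fin n, X i.succ,
      C.interference x = D ∘ₘ Measure.pi fun i => C.direct i (x i)) :
    C.interferenceLaw p = D ∘ₘ Measure.pi (C.outputLaw p) := by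
  have hcomp : C.interference = D ∘ₖ piKernel C.direct := by
    ext1 x
    rw [Kernel.comp_apply, piKernel_apply, hD]
  unfold outputLaw
  rw [interferenceLaw, hcomp, ← Measure.comp_assoc, piKernel_comp_pi]

end ManyToOneChannel

/-! ## The converse -/

section Block

open InformationTheory

variable {A : Type*} [MeasurableSpace A] (u : Measure A)

lemma comap_comp_eq_comp_map {X B : Type*} [MeasurableSpace X] [MeasurableSpace B] {φ : A → X}
    (hφ : Measurable φ) (κ : Kernel X B) : κ.comap φ hφ ∘ₘ u = κ ∘ₘ u.map φ := by
  rw [← Kernel.comp_deterministic_eq_comap, ← Measure.comp_assoc,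
    Measure.deterministic_comp_eq_map]

variable [IsProbabilityMeasure u]

lemma klDiv_compProd_comap_le_mutualInformation {X B : Type*} [MeasurableSpace X]
    [MeasurableSpace B] {φ : A → X} (hφ : Measurable φ) (κ : Kernel X B) [IsMarkovKernel κ] :
    klDiv (u ⊗ₘ κ.comap φ hφ) (u.prod (κ ∘ₘ u.map φ)) ≤ mutualInformation (u.map φ ⊗ₘ κ) := by
  have := Measure.isProbabilityMeasure_map (μ := u) hφ.aemeasurable
  rw [mutualInformation_compProd, ← Measure.compProd_const, ← Measure.compProd_const]
  exact klDiv_compProd_comap_le u hφ κ (Kernel.const _ (κ ∘ₘ u.map φ))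

lemma mutualInformation_compProd_add_klDiv_le [Countable A] [MeasurableSingletonClass A]
    {ι : Type*} [Fintype ι] {X B : ι → Type*} [∀ t, MeasurableSpace (X t)]
    [∀ t, MeasurableSpace (B t)] {φ : ∀ t, A → X t} (hφ : ∀ t, Measurable (φ t))
    (κ : ∀ t, Kernel (X t) (B t)) [∀ t, IsMarkovKernel (κ t)] (K : Kernel A (∀ t, B t))
    [IsMarkovKernel K] (hK : ∀ a t, (K a).map (Function.eval t) = κ t (φ t a)) {c : ℝ≥0∞}
    (hc : ∀ a, klDiv (K a) (Measure.pi fun t => κ t (φ t a)) ≤ c) :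
    mutualInformation (u ⊗ₘ K) + klDiv (K ∘ₘ u) (Measure.pi fun t => κ t ∘ₘ u.map (φ t)) ≤
      c + ∑ t, mutualInformation (u.map (φ t) ⊗ₘ κ t) := by
  have (t : ι) := Measure.isProbabilityMeasure_map (μ := u) (hφ t).aemeasurable
  have hsymbol (t : ι) : K.map (Function.eval t) = (κ t).comap (φ t) (hφ t) := by
    ext1 a
    rw [Kernel.map_apply _ (measurable_pi_apply t), hK, Kernel.comap_apply]
  simp_rw [← hK] at hc
  rw [← klDiv_compProd_prod_eq_add]
  refine (klDiv_compProd_pi_le_add_sum u K _ hc).trans ?_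
  gcongr with t
  rw [hsymbol]
  exact klDiv_compProd_comap_le_mutualInformation u (hφ t) (κ t)

end Block

namespace ManyToOneChannel

open InformationTheory Real

variable {n : ℕ} {X Y : Fin (n + 1) → Type*} {V : Type*}
  [∀ i, MeasurableSpace (X i)] [∀ i, MeasurableSpace (Y i)] [MeasurableSpace V]
  (C : ManyToOneChannel n X Y V)

section Coded

variable {W : Fin (n + 1) → Type*} [∀ i, MeasurableSpace (W i)] [∀ i, Countable (W i)]
  [∀ i, MeasurableSingletonClass (W i)] {T : ℕ} (enc : ∀ i, W i → Fin T → X i)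

/-- The many-to-one channel from messages to output blocks formed by the encoders `enc` and `T`
uses of `C`. Seeing a block code as a single use of a channel of the same kind lets the
single-letter description of the links apply to whole blocks. -/
def coded : ManyToOneChannel n W (fun i => Fin T → Y i) (Fin T → V) where
  direct i := (piKernel fun _ => C.direct i).comap (enc i.succ) (measurable_of_countable _)
  markov_direct _ := inferInstance
  law := ((piKernel fun _ => C.law).comap (fun w τ i => enc i.succ (w i) τ)
    (measurable_of_countable _)).map fun z => (fun τ => (z τ).1, fun i τ => (z τ).2 i)
  markov_law := Kernel.IsMarkovKernel.map _ (by fun_prop)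
  law_output w i := by
    rw [Kernel.map_apply _ (by fun_prop), Measure.map_map (by fun_prop) (by fun_prop),
      Kernel.comap_apply, Kernel.comap_apply, piKernel_apply, piKernel_apply]
    have (τ : Fin T) : IsProbabilityMeasure
        ((C.law fun j => enc j.succ (w j) τ).map fun q => q.2 i) :=
      Measure.isProbabilityMeasure_map (by fun_prop)
    simp_rw [← fun τ => C.law_output (fun j => enc j.succ (w j) τ) i]
    exact Measure.pi_map_pi (f := fun _ (q : V × ∀ j : Fin n, Y j.succ) => q.2 i)
      fun τ => by fun_prop
  f z τ := C.f (enc 0 z.1 τ, z.2 τ)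
  measurable_f := measurable_from_prod_countable_right fun w =>
    measurable_pi_lambda _ fun τ => (C.measurable_f_right (enc 0 w τ)).comp (measurable_pi_apply τ)
  invertible := by
    obtain ⟨g, hg, hgf⟩ := C.invertible
    exact ⟨fun z τ => g (z.1 τ, enc 0 z.2 τ), measurable_from_prod_countable_left fun w =>
      by fun_prop, fun w v => funext fun τ => hgf _ _⟩

lemma coded_channel_apply (w : ∀ i, W i) :
    (C.coded enc).channel w =
      (Measure.pi fun τ => C.channel fun i => enc i (w i) τ).map fun y i τ => y τ i := by
  have hassemble (τ : Fin T) : Measurable fun q => C.assemble (fun i => enc i (w i) τ, q) :=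
    C.measurable_assemble_right _
  have hblock : Measurable fun (z : Fin T → V × ∀ i : Fin n, Y i.succ) τ =>
      C.assemble (fun i => enc i (w i) τ, z τ) :=
    measurable_pi_lambda _ fun τ => (hassemble τ).comp (measurable_pi_apply τ)
  have (τ : Fin T) := Measure.isProbabilityMeasure_map
    (μ := C.law fun i => enc i.succ (w i.succ) τ) (hassemble τ).aemeasurable
  have hlaw : (C.coded enc).law (fun i => w i.succ) =
      (Measure.pi fun τ => C.law fun i => enc i.succ (w i.succ) τ).map
        fun z => (fun τ => (z τ).1, fun i τ => (z τ).2 i) :=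
    Kernel.map_apply _ (by fun_prop) _
  simp_rw [channel_apply]
  rw [hlaw, ← Measure.pi_map_pi fun τ => (hassemble τ).aemeasurable,
    Measure.map_map ((C.coded enc).measurable_assemble_right w) (by fun_prop),
    Measure.map_map (by fun_prop) hblock]
  congr 1
  ext z i
  cases i using Fin.cases <;> rfl

lemma coded_interference :
    (C.coded enc).interference =
      (piKernel fun _ => C.interference).comap (fun w τ i => enc i.succ (w i) τ)
        (measurable_of_countable _) := by
  ext1 w
  have (τ : Fin T) := Measure.isProbabilityMeasure_map
    (μ := C.law fun i => enc i.succ (w i) τ) measurable_fst.aemeasurable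
  rw [interference, Kernel.fst_apply, coded, Kernel.map_apply _ (by fun_prop),
    Measure.map_map measurable_fst (by fun_prop)]
  exact Measure.pi_map_pi fun τ => measurable_fst.aemeasurable

lemma coded_interference_eq_comp_pi {D : Kernel (∀ i : Fin n, Y i.succ) V} [IsMarkovKernel D]
    (hD : ∀ x : ∀ i : Fin n, X i.succ,
      C.interference x = D ∘ₘ Measure.pi fun i => C.direct i (x i)) (w : ∀ i : Fin n, W i.succ) :
    (C.coded enc).interference w =
      (piKernel fun _ => D).comap (fun y τ i => y i τ) (by fun_prop) ∘ₘ
        Measure.pi fun i => (C.coded enc).direct i (w i) := by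
  have hdirect (i : Fin n) : (C.coded enc).direct i (w i) =
      Measure.pi fun τ => C.direct i (enc i.succ (w i) τ) := rfl
  rw [coded_interference, comap_comp_eq_comp_map, Kernel.comap_apply, piKernel_apply]
  simp_rw [hdirect, hD]
  rw [map_pi_pi_swap fun i τ => C.direct i (enc i.succ (w i) τ), piKernel_comp_pi]

/-- The law of the channel inputs at time `τ` when the messages are independent with laws `p`. -/
def symbolLaw (p : ∀ i, ProbabilityMeasure (W i)) (τ : Fin T) (i : Fin (n + 1)) :
    ProbabilityMeasure (X i) :=
  (p i).map (f := fun w => enc i w τ) (measurable_of_countable _).aemeasurable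

variable (p : ∀ i, ProbabilityMeasure (W i))

lemma map_eval_interferenceLaw_coded (τ : Fin T) :
    ((C.coded enc).interferenceLaw p).map (Function.eval τ) =
      C.interferenceLaw (symbolLaw enc p τ) := by
  have (i : Fin n) : IsProbabilityMeasure
      ((p i.succ : Measure (W i.succ)).map fun w => enc i.succ w τ) :=
    Measure.isProbabilityMeasure_map (measurable_of_countable _).aemeasurable
  rw [interferenceLaw, coded_interference, comap_comp_eq_comp_map, map_eval_piKernel_comp,
    Measure.map_map (measurable_pi_apply τ) (measurable_of_countable _)]
  exact congrArg (C.interference ∘ₘ ·) (Measure.pi_map_pi (f := fun (i : Fin n) w => enc i.succ w τ)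
    fun i => (measurable_of_countable _).aemeasurable)

lemma userInfo_coded_succ_add_klDiv_le (i : Fin n) :
    (C.coded enc).userInfo p i.succ + klDiv ((C.coded enc).outputLaw p i)
        (Measure.pi fun τ => C.outputLaw (symbolLaw enc p τ) i) ≤
      ∑ τ, C.userInfo (symbolLaw enc p τ) i.succ := by
  simp_rw [userInfo, userLaw_succ]
  refine (mutualInformation_compProd_add_klDiv_le _ (φ := fun τ w => enc i.succ w τ)
    (fun _ => measurable_of_countable _) (fun _ => C.direct i) _
    (fun w τ => (measurePreserving_eval _ τ).map_eq) (c := 0) fun w => ?_).trans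
    (zero_add _).le
  exact (klDiv_self _).le

lemma userInfo_coded_zero_le :
    (C.coded enc).userInfo p 0 ≤
      klDiv ((C.coded enc).interferenceLaw p)
        (Measure.pi fun τ => C.interferenceLaw (symbolLaw enc p τ)) +
      ∑ τ, C.userInfo (symbolLaw enc p τ) 0 := by
  have hblock (w : W 0) : Measurable fun (v : Fin T → V) τ => C.f (enc 0 w τ, v τ) :=
    (C.coded enc).measurable_f_right w
  have hlink (w : W 0) : (C.coded enc).linkZero ((C.coded enc).interferenceLaw p) w =
      ((C.coded enc).interferenceLaw p).map fun v τ => C.f (enc 0 w τ, v τ) :=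
    (C.coded enc).linkZero_apply _ w
  simp_rw [userInfo, userLaw_zero]
  refine le_self_add.trans (mutualInformation_compProd_add_klDiv_le _
    (φ := fun τ w => enc 0 w τ) (fun _ => measurable_of_countable _)
    (fun τ => C.linkZero (C.interferenceLaw (symbolLaw enc p τ))) _ (fun w τ => ?_) fun w => ?_)
  · rw [hlink, linkZero_apply, ← map_eval_interferenceLaw_coded,
      Measure.map_map (measurable_pi_apply τ) (hblock w),
      Measure.map_map (C.measurable_f_right _) (measurable_pi_apply τ)]
    rfl
  · have (τ : Fin T) := Measure.isProbabilityMeasure_map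
      (μ := C.interferenceLaw (symbolLaw enc p τ)) (C.measurable_f_right (enc 0 w τ)).aemeasurable
    simp_rw [hlink, linkZero_apply]
    rw [← Measure.pi_map_pi fun τ => (C.measurable_f_right _).aemeasurable]
    exact klDiv_map_le _ _ (hblock w)

lemma klDiv_interferenceLaw_coded_le (hC : C.IsDegraded) :
    klDiv ((C.coded enc).interferenceLaw p)
        (Measure.pi fun τ => C.interferenceLaw (symbolLaw enc p τ)) ≤
      ∑ i, klDiv ((C.coded enc).outputLaw p i)
        (Measure.pi fun τ => C.outputLaw (symbolLaw enc p τ) i) := by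
  obtain ⟨D, hDM, hD⟩ := hC
  have hblock := (C.coded enc).interferenceLaw_eq_comp_pi_outputLaw p
    (C.coded_interference_eq_comp_pi enc hD)
  have hsymbol : (Measure.pi fun τ => C.interferenceLaw (symbolLaw enc p τ)) =
      (piKernel fun _ => D).comap (fun y τ i => y i τ) (by fun_prop) ∘ₘ
        Measure.pi fun i => Measure.pi fun τ => C.outputLaw (symbolLaw enc p τ) i := by
    simp_rw [comap_comp_eq_comp_map, C.interferenceLaw_eq_comp_pi_outputLaw _ hD]
    rw [map_pi_pi_swap fun i τ => C.outputLaw (symbolLaw enc p τ) i, piKernel_comp_pi]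
  rw [hblock, hsymbol]
  exact (klDiv_comp_right_le _ _ _).trans (klDiv_pi_pi_le_sum _ _)

/-- User `0` gains from the memory of the interference at most what the other users lose by the
memory of their outputs, because the interference is a degraded version of these outputs. -/
lemma sum_userInfo_coded_le (hC : C.IsDegraded) :
    ∑ i, (C.coded enc).userInfo p i ≤ ∑ τ, ∑ i, C.userInfo (symbolLaw enc p τ) i := by
  set memory : Fin n → ℝ≥0∞ := fun i => klDiv ((C.coded enc).outputLaw p i)
    (Measure.pi fun τ => C.outputLaw (symbolLaw enc p τ) i)
  calc ∑ i, (C.coded enc).userInfo p i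
      = (C.coded enc).userInfo p 0 + ∑ i : Fin n, (C.coded enc).userInfo p i.succ :=
        Fin.sum_univ_succ _
    _ ≤ (∑ i, memory i + ∑ τ, C.userInfo (symbolLaw enc p τ) 0) +
          ∑ i : Fin n, (C.coded enc).userInfo p i.succ := by
        gcongr
        refine (C.userInfo_coded_zero_le enc p).trans ?_
        gcongr
        exact C.klDiv_interferenceLaw_coded_le enc p hC
    _ = ∑ τ, C.userInfo (symbolLaw enc p τ) 0 +
          ∑ i : Fin n, ((C.coded enc).userInfo p i.succ + memory i) := by
        rw [Finset.sum_add_distrib]; ring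
    _ ≤ ∑ τ, C.userInfo (symbolLaw enc p τ) 0 +
          ∑ i : Fin n, ∑ τ, C.userInfo (symbolLaw enc p τ) i.succ := by
        gcongr with i
        exact C.userInfo_coded_succ_add_klDiv_le enc p i
    _ = ∑ τ, ∑ i, C.userInfo (symbolLaw enc p τ) i := by
        rw [Finset.sum_comm (s := Finset.univ (α := Fin T)), Fin.sum_univ_succ]

end Coded

section Converse

variable {T : ℕ} {M : Fin (n + 1) → ℕ} [∀ i, NeZero (M i)]

/-- The uniform laws of the messages. -/
def uniformMessages (M : Fin (n + 1) → ℕ) [∀ i, NeZero (M i)] (i : Fin (n + 1)) :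
    ProbabilityMeasure (Fin (M i)) :=
  ⟨uniformOn Set.univ, inferInstance⟩

variable (enc : ∀ i, Fin (M i) → Fin T → X i) {dec : ∀ i, (Fin T → Y i) → Fin (M i)}

lemma errorProb_eq_compProd (hdec : ∀ i, Measurable (dec i)) :
    C.errorProb enc dec =
      ((Measure.pi fun i => (uniformMessages M i : Measure (Fin (M i)))) ⊗ₘ
        (C.coded enc).channel) {z | ∃ i, dec i (z.2 i) ≠ z.1 i} := by
  have hset : MeasurableSet {z : (∀ i, Fin (M i)) × (∀ i, Fin T → Y i) |
      ∃ i, dec i (z.2 i) ≠ z.1 i} := by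
    measurability
  rw [Measure.compProd_apply hset]
  change _ = ∫⁻ w, _ ∂(Measure.pi fun i => uniformOn Set.univ)
  rw [pi_uniformOn_univ, lintegral_uniformOn_univ, Fintype.card_pi, errorProb]
  simp only [Fintype.card_fin, Nat.cast_prod]
  congr 1
  refine Finset.sum_congr rfl fun w _ => ?_
  rw [coded_channel_apply, Measure.map_apply (by fun_prop) (measurable_prodMk_left hset)]
  rfl

lemma userLaw_coded_error_le (hdec : ∀ i, Measurable (dec i)) (i : Fin (n + 1)) :
    (C.coded enc).userLaw (uniformMessages M) i {z | dec i z.2 ≠ z.1} ≤ C.errorProb enc dec := by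
  have hset : MeasurableSet {z : Fin (M i) × (Fin T → Y i) | dec i z.2 ≠ z.1} := by
    measurability
  rw [C.errorProb_eq_compProd enc hdec, userLaw, Measure.map_apply (by fun_prop) hset]
  exact measure_mono fun z hz => ⟨i, hz⟩

lemma sum_one_sub_mul_log_le (hC : C.IsDegraded) {S : ℝ≥0∞} (hS : S ≠ ∞)
    (hI : ∀ p : ∀ i, ProbabilityMeasure (X i), ∑ i, C.userInfo p i ≤ S)
    (hdec : ∀ i, Measurable (dec i)) {δ : Fin (n + 1) → ℝ}
    (hδ : ∀ i, δ i = ((C.coded enc).userLaw (uniformMessages M) i).real {z | dec i z.2 ≠ z.1}) :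
    ∑ i, (1 - δ i) * log (M i) ≤ T * S.toReal + ∑ i, binEntropy (δ i) := by
  have hsum : ∑ i, (C.coded enc).userInfo (uniformMessages M) i ≤ T * S :=
    (C.sum_userInfo_coded_le enc _ hC).trans ((Finset.sum_le_sum fun τ _ => hI _).trans (by simp))
  have hTS : (T : ℝ≥0∞) * S ≠ ∞ := ENNReal.mul_ne_top (by simp) hS
  have hfin (i) : (C.coded enc).userInfo (uniformMessages M) i ≠ ∞ :=
    ENNReal.sum_ne_top.1 (ne_top_of_le_ne_top hTS hsum) i (Finset.mem_univ i)
  have hfano (i) : (1 - δ i) * log (M i) ≤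
      ((C.coded enc).userInfo (uniformMessages M) i).toReal + binEntropy (δ i) := by
    have := one_sub_mul_log_card_le_toReal_mutualInformation_add_binEntropy
      ((C.coded enc).fst_userLaw _ i) (hfin i) (hdec i)
    rwa [← hδ, Fintype.card_fin] at this
  calc ∑ i, (1 - δ i) * log (M i)
      ≤ ∑ i, ((C.coded enc).userInfo (uniformMessages M) i).toReal + ∑ i, binEntropy (δ i) :=
        (Finset.sum_le_sum fun i _ => hfano i).trans_eq Finset.sum_add_distrib
    _ ≤ T * S.toReal + ∑ i, binEntropy (δ i) := by
        rw [← ENNReal.toReal_sum fun i _ => hfin i]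
        gcongr
        simpa using ENNReal.toReal_mono hTS hsum

end Converse

lemma sum_rate_le (hC : C.IsDegraded) {S : ℝ≥0∞}
    (hI : ∀ p : ∀ i, ProbabilityMeasure (X i), ∑ i, C.userInfo p i ≤ S)
    {R : Fin (n + 1) → ℝ} {T : ℕ → ℕ} {M : ℕ → Fin (n + 1) → ℕ}
    (enc : ∀ k i, Fin (M k i) → Fin (T k) → X i)
    (dec : ∀ k i, (Fin (T k) → Y i) → Fin (M k i)) (hT : ∀ k, 0 < T k) (hM : ∀ k i, 0 < M k i)
    (hdec : ∀ k i, Measurable (dec k i)) (hR : ∀ k i, R i ≤ log (M k i) / T k)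
    (hlim : Tendsto (fun k => C.errorProb (enc k) (dec k)) atTop (𝓝 0)) :
    ENNReal.ofReal (∑ i, R i) ≤ S := by
  rcases eq_or_ne S ∞ with rfl | hS
  · exact le_top
  refine ENNReal.ofReal_le_of_le_toReal ?_
  have (k : ℕ) (i : Fin (n + 1)) : NeZero (M k i) := ⟨(hM k i).ne'⟩
  set δ : ℕ → Fin (n + 1) → ℝ := fun k i =>
    ((C.coded (enc k)).userLaw (uniformMessages (M k)) i).real {z | dec k i z.2 ≠ z.1}
  have hδ (i) : Tendsto (δ · i) atTop (𝓝 0) :=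
    (ENNReal.tendsto_toReal ENNReal.zero_ne_top).comp (tendsto_of_tendsto_of_tendsto_of_le_of_le
      tendsto_const_nhds hlim (fun _ => zero_le)
      fun k => C.userLaw_coded_error_le (enc k) (hdec k) i)
  have hbound (k) : ∑ i, ((1 - δ k i) * R i - binEntropy (δ k i)) ≤ S.toReal := by
    have hT_one : (1 : ℝ) ≤ T k := by exact_mod_cast hT k
    have hT_pos : (0 : ℝ) < T k := by linarith
    have hδ_le (i) : δ k i ≤ 1 := measureReal_le_one
    have hentropy : 0 ≤ ∑ i, binEntropy (δ k i) :=
      Finset.sum_nonneg fun i _ => binEntropy_nonneg measureReal_nonneg (hδ_le i)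
    have hrate : T k * ∑ i, (1 - δ k i) * R i ≤ ∑ i, (1 - δ k i) * log (M k i) := by
      rw [Finset.mul_sum]
      refine Finset.sum_le_sum fun i _ => ?_
      have := mul_le_mul_of_nonneg_left ((le_div_iff₀' hT_pos).1 (hR k i))
        (sub_nonneg.2 (hδ_le i))
      linarith
    have hcode := C.sum_one_sub_mul_log_le (enc k) hC hS hI (hdec k) fun _ => rfl
    rw [Finset.sum_sub_distrib, sub_le_iff_le_add]
    refine le_of_mul_le_mul_left ?_ hT_pos
    rw [mul_add]
    exact hrate.trans (hcode.trans (by gcongr; exact le_mul_of_one_le_left hentropy hT_one))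
  have hlimit : Tendsto (fun k => ∑ i, ((1 - δ k i) * R i - binEntropy (δ k i))) atTop
      (𝓝 (∑ i, ((1 - 0) * R i - binEntropy 0))) :=
    tendsto_finsetSum _ fun i _ => ((tendsto_const_nhds.sub (hδ i)).mul_const _).sub
      ((binEntropy_continuous.tendsto 0).comp (hδ i))
  simpa using le_of_tendsto' hlimit hbound

lemma sum_rate_le_of_mem_capacityRegion (hC : C.IsDegraded) {S : ℝ≥0∞}
    (hI : ∀ p : ∀ i, ProbabilityMeasure (X i), ∑ i, C.userInfo p i ≤ S)
    {R : Fin (n + 1) → ℝ} (hR : R ∈ C.capacityRegion) : ENNReal.ofReal (∑ i, R i) ≤ S := by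
  have hclosed : IsClosed {R : Fin (n + 1) → ℝ | ENNReal.ofReal (∑ i, R i) ≤ S} :=
    isClosed_le (ENNReal.continuous_ofReal.comp (by fun_prop)) continuous_const
  refine closure_minimal ?_ hclosed hR
  rintro R ⟨T, M, enc, dec, hT, hM, hdec, hRM, hlim⟩
  exact C.sum_rate_le hC hI enc dec hT hM hdec (fun k i => (hRM k i).le) hlim

end ManyToOneChannel

/-! ## Chernoff bounds for the likelihood ratio -/

section Chernoff

open InformationTheory Real

/-- The integrand of the Tsallis relative entropy of order `1 - s`, normalised like `klFun`, which
is its limit as `s → 0`. -/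
def tsallisFun (s r : ℝ) : ℝ := (r - r ^ (1 - s)) / s + 1 - r

lemma measurable_tsallisFun (s : ℝ) : Measurable (tsallisFun s) := by
  unfold tsallisFun
  fun_prop

lemma rpow_one_sub_le {r s : ℝ} (hr : 0 ≤ r) (hs : 0 ≤ s) (hs' : s ≤ 1) :
    r ^ (1 - s) ≤ (1 - s) * r + s := by
  simpa using Real.geom_mean_le_arith_mean2_weighted (sub_nonneg.2 hs') hs hr zero_le_one
    (sub_add_cancel 1 s)

lemma tsallisFun_nonneg {r s : ℝ} (hr : 0 ≤ r) (hs : 0 < s) (hs' : s ≤ 1) :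
    0 ≤ tsallisFun s r := by
  have h : r - 1 ≤ (r - r ^ (1 - s)) / s := by
    rw [le_div_iff₀ hs]
    linarith [rpow_one_sub_le hr hs.le hs']
  rw [tsallisFun]
  linarith

lemma tendsto_tsallisFun {r : ℝ} (hr : 0 ≤ r) :
    Tendsto (fun s => tsallisFun s r) (𝓝[>] 0) (𝓝 (klFun r)) := by
  rcases hr.eq_or_lt with rfl | hr
  · rw [klFun_zero]
    refine tendsto_const_nhds.congr' ?_
    filter_upwards [mem_nhdsWithin_of_mem_nhds (Iio_mem_nhds (zero_lt_one' ℝ))] with s hs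
    simp [tsallisFun, Real.zero_rpow (sub_pos.2 (Set.mem_Iio.1 hs)).ne']
  · have hderiv : HasDerivAt (fun s : ℝ => r ^ (1 - s)) (-(r * log r)) 0 := by
      have := (Real.hasStrictDerivAt_const_rpow hr (1 - 0)).hasDerivAt.comp 0
        ((hasDerivAt_id (0 : ℝ)).const_sub 1)
      simpa [Function.comp_def] using this
    have hlim := (hderiv.tendsto_slope_zero_right.neg.add_const 1).sub_const r
    rw [neg_neg, ← klFun_apply] at hlim
    refine hlim.congr fun s => ?_
    simp only [zero_add, sub_zero, Real.rpow_one, smul_eq_mul, tsallisFun]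
    ring

variable {Ω : Type*} [MeasurableSpace Ω] {P Q : Measure Ω}

lemma klDiv_le_of_lintegral_tsallisFun_le [IsFiniteMeasure P] [IsFiniteMeasure Q]
    (hPQ : P ≪ Q) {c : ℝ≥0∞}
    (h : ∀ s : ℝ, 0 < s → s < 1 →
      ∫⁻ x, ENNReal.ofReal (tsallisFun s (P.rnDeriv Q x).toReal) ∂Q ≤ c) :
    klDiv P Q ≤ c := by
  obtain ⟨u, -, hu, hlim⟩ := exists_seq_strictAnti_tendsto' (zero_lt_one' ℝ)
  have hlim' : Tendsto u atTop (𝓝[>] 0) :=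
    tendsto_nhdsWithin_iff.2 ⟨hlim, .of_forall fun k => (hu k).1⟩
  have hr : Measurable fun x => (P.rnDeriv Q x).toReal :=
    (Measure.measurable_rnDeriv P Q).ennreal_toReal
  calc klDiv P Q
      = ∫⁻ x, ENNReal.ofReal (klFun (P.rnDeriv Q x).toReal) ∂Q := klDiv_eq_lintegral_klFun_of_ac hPQ
    _ = ∫⁻ x, liminf (fun k => ENNReal.ofReal (tsallisFun (u k) (P.rnDeriv Q x).toReal)) atTop ∂Q :=
        lintegral_congr fun x => ((ENNReal.continuous_ofReal.tendsto _).comp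
          ((tendsto_tsallisFun ENNReal.toReal_nonneg).comp hlim')).liminf_eq.symm
    _ ≤ liminf (fun k => ∫⁻ x, ENNReal.ofReal (tsallisFun (u k) (P.rnDeriv Q x).toReal) ∂Q) atTop :=
        lintegral_liminf_le fun k => ((measurable_tsallisFun _).comp hr).ennreal_ofReal
    _ ≤ c := liminf_le_of_frequently_le' (.of_forall fun k => h _ (hu k).1 (hu k).2)

lemma integrable_toReal_rnDeriv_rpow [IsFiniteMeasure P] [IsFiniteMeasure Q] {s : ℝ} (hs : 0 ≤ s)
    (hs' : s ≤ 1) :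
    Integrable (fun x => (P.rnDeriv Q x).toReal ^ (1 - s)) Q := by
  have hr : Integrable (fun x => (P.rnDeriv Q x).toReal) Q := Measure.integrable_toReal_rnDeriv
  refine Integrable.mono' ((hr.const_mul (1 - s)).add (integrable_const s))
    (hr.aestronglyMeasurable.aemeasurable.pow_const _).aestronglyMeasurable
    (ae_of_all _ fun x => ?_)
  rw [Real.norm_of_nonneg (by positivity)]
  exact rpow_one_sub_le ENNReal.toReal_nonneg hs hs'

lemma lintegral_inv_rnDeriv_rpow [IsFiniteMeasure P] [IsFiniteMeasure Q] (hPQ : P ≪ Q) {s : ℝ}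
    (hs : 0 < s) (hs' : s < 1) :
    ∫⁻ x, ((P.rnDeriv Q x)⁻¹) ^ s ∂P =
      ENNReal.ofReal (∫ x, (P.rnDeriv Q x).toReal ^ (1 - s) ∂Q) := by
  rw [ofReal_integral_eq_lintegral_ofReal (integrable_toReal_rnDeriv_rpow hs.le hs'.le)
    (ae_of_all _ fun x => Real.rpow_nonneg ENNReal.toReal_nonneg _),
    ← lintegral_rnDeriv_mul hPQ (by fun_prop)]
  refine lintegral_congr_ae ?_
  filter_upwards [Measure.rnDeriv_lt_top P Q] with x hx
  by_cases h0 : P.rnDeriv Q x = 0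
  · simp [h0, Real.zero_rpow (sub_pos.2 hs').ne']
  · rw [← ENNReal.ofReal_rpow_of_nonneg ENNReal.toReal_nonneg (sub_nonneg.2 hs'.le),
      ENNReal.ofReal_toReal hx.ne, ENNReal.inv_rpow, ← ENNReal.rpow_neg, sub_eq_add_neg,
      ENNReal.rpow_add _ _ h0 hx.ne, ENNReal.rpow_one]

lemma lintegral_tsallisFun_rnDeriv [IsProbabilityMeasure P] [IsProbabilityMeasure Q]
    (hPQ : P ≪ Q) {s : ℝ} (hs : 0 < s) (hs' : s ≤ 1) :
    ∫⁻ x, ENNReal.ofReal (tsallisFun s (P.rnDeriv Q x).toReal) ∂Q =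
      ENNReal.ofReal ((1 - ∫ x, (P.rnDeriv Q x).toReal ^ (1 - s) ∂Q) / s) := by
  have hr : Integrable (fun x => (P.rnDeriv Q x).toReal) Q := Measure.integrable_toReal_rnDeriv
  have hpow : Integrable (fun x => (P.rnDeriv Q x).toReal ^ (1 - s)) Q :=
    integrable_toReal_rnDeriv_rpow hs.le hs'
  have hdiv : Integrable (fun x =>
      ((P.rnDeriv Q x).toReal - (P.rnDeriv Q x).toReal ^ (1 - s)) / s) Q :=
    (hr.sub hpow).div_const s
  have hint : Integrable (fun x => tsallisFun s (P.rnDeriv Q x).toReal) Q :=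
    (hdiv.add (integrable_const 1)).sub hr
  rw [← ofReal_integral_eq_lintegral_ofReal hint (ae_of_all _ fun x =>
    tsallisFun_nonneg ENNReal.toReal_nonneg hs hs')]
  congr 1
  calc ∫ x, tsallisFun s (P.rnDeriv Q x).toReal ∂Q
      = (∫ x, (P.rnDeriv Q x).toReal ∂Q - ∫ x, (P.rnDeriv Q x).toReal ^ (1 - s) ∂Q) / s
        + ∫ _, 1 ∂Q - ∫ x, (P.rnDeriv Q x).toReal ∂Q := by
        rw [← integral_sub hr hpow, ← integral_div, ← integral_add hdiv (integrable_const 1)]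
        exact integral_sub (hdiv.add (integrable_const 1)) hr
    _ = (1 - ∫ x, (P.rnDeriv Q x).toReal ^ (1 - s) ∂Q) / s := by
        simp [Measure.integral_toReal_rnDeriv hPQ]

lemma exists_lintegral_inv_rnDeriv_rpow_lt [IsProbabilityMeasure P] [IsProbabilityMeasure Q]
    (hPQ : P ≪ Q) {γ : ℝ} (hγ : ENNReal.ofReal γ < klDiv P Q) :
    ∃ s : ℝ, 0 < s ∧ ∫⁻ x, ((P.rnDeriv Q x)⁻¹) ^ s ∂P < ENNReal.ofReal (exp (-(s * γ))) := by
  by_contra! hcon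
  refine hγ.not_ge (klDiv_le_of_lintegral_tsallisFun_le hPQ fun s hs hs' => ?_)
  have hexp : exp (-(s * γ)) ≤ ∫ x, (P.rnDeriv Q x).toReal ^ (1 - s) ∂Q := by
    have h := hcon s hs
    rwa [lintegral_inv_rnDeriv_rpow hPQ hs hs', ENNReal.ofReal_le_ofReal_iff
      (integral_nonneg fun x => Real.rpow_nonneg ENNReal.toReal_nonneg _)] at h
  rw [lintegral_tsallisFun_rnDeriv hPQ hs hs'.le]
  refine ENNReal.ofReal_le_ofReal ?_
  rw [div_le_iff₀ hs]
  linarith [Real.add_one_le_exp (-(s * γ))]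

lemma rpow_le_one_add_ofReal_mul (x : ℝ≥0∞) {s : ℝ} (hs : 0 < s) (hs' : s ≤ 1) :
    x ^ s ≤ 1 + ENNReal.ofReal s * x := by
  rcases eq_or_ne x ∞ with rfl | hx
  · simp [ENNReal.mul_top, hs]
  have hreal : x.toReal ^ s ≤ 1 + s * x.toReal := by
    have h := Real.geom_mean_le_arith_mean2_weighted hs.le (sub_nonneg.2 hs')
      (ENNReal.toReal_nonneg (a := x)) zero_le_one (add_sub_cancel s 1)
    rw [Real.one_rpow, mul_one, mul_one] at h
    linarith
  calc x ^ s = ENNReal.ofReal (x.toReal ^ s) := by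
        rw [← ENNReal.ofReal_rpow_of_nonneg ENNReal.toReal_nonneg hs.le, ENNReal.ofReal_toReal hx]
    _ ≤ ENNReal.ofReal (1 + s * x.toReal) := ENNReal.ofReal_le_ofReal hreal
    _ = 1 + ENNReal.ofReal s * x := by
        rw [ENNReal.ofReal_add zero_le_one (by positivity), ENNReal.ofReal_mul hs.le,
          ENNReal.ofReal_toReal hx, ENNReal.ofReal_one]

/-- When `P` is not absolutely continuous, `ρ` stands for the density of the reference measure with
respect to `P`: it vanishes on a set `E` that `P` charges. -/
lemma exists_lintegral_rpow_lt_of_ae_eq_zero [IsProbabilityMeasure P] {ρ : Ω → ℝ≥0∞}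
    (hρ : Measurable ρ) (hρ' : ∫⁻ x, ρ x ∂P ≤ 1) {E : Set Ω} (hE : MeasurableSet E) (hPE : P E ≠ 0)
    (h0 : ∀ᵐ x ∂P, x ∈ E → ρ x = 0) (γ : ℝ) :
    ∃ s : ℝ, 0 < s ∧ ∫⁻ x, ρ x ^ s ∂P < ENNReal.ofReal (exp (-(s * γ))) := by
  have hPlt : P.real Eᶜ < 1 := by
    rw [probReal_compl_eq_one_sub hE]
    linarith [ENNReal.toReal_pos hPE (measure_ne_top _ _), measureReal_def P E]
  have hev : ∀ᶠ s : ℝ in 𝓝 0, P.real Eᶜ + s < exp (-(s * γ)) :=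
    ContinuousAt.eventually_lt (by fun_prop) (by fun_prop) (by simpa using hPlt)
  obtain ⟨s, hs, hs1, hs0⟩ : ∃ s, P.real Eᶜ + s < exp (-(s * γ)) ∧ s ≤ 1 ∧ 0 < s :=
    ((hev.filter_mono nhdsWithin_le_nhds).and (((eventually_le_nhds zero_lt_one).filter_mono
      nhdsWithin_le_nhds).and (eventually_mem_nhdsWithin (a := 0) (s := Set.Ioi 0)))).exists
  refine ⟨s, hs0, lt_of_le_of_lt ?_ ((ENNReal.ofReal_lt_ofReal_iff (exp_pos _)).2 hs)⟩
  calc ∫⁻ x, ρ x ^ s ∂P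
      ≤ ∫⁻ x, (Eᶜ.indicator 1 x + ENNReal.ofReal s * ρ x) ∂P := by
        refine lintegral_mono_ae ?_
        filter_upwards [h0] with x hx
        by_cases hxE : x ∈ E
        · simp [hx hxE, hxE, hs0]
        · simpa [hxE] using rpow_le_one_add_ofReal_mul (ρ x) hs0 hs1
    _ = P Eᶜ + ENNReal.ofReal s * ∫⁻ x, ρ x ∂P := by
        rw [lintegral_add_left (measurable_one.indicator hE.compl),
          lintegral_indicator_one hE.compl, lintegral_const_mul _ hρ]
    _ ≤ ENNReal.ofReal (P.real Eᶜ + s) := by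
        rw [ENNReal.ofReal_add measureReal_nonneg hs0.le, ofReal_measureReal]
        gcongr
        exact mul_le_of_le_one_right zero_le hρ'

lemma pi_exp_le_prod_le [IsProbabilityMeasure P] {f : Ω → ℝ≥0∞} (hf : Measurable f) (c : ℝ)
    (T : ℕ) :
    (Measure.pi fun _ : Fin T => P) {z | ENNReal.ofReal (exp (T * c)) ≤ ∏ τ, f (z τ)} ≤
      (ENNReal.ofReal (exp (-c)) * ∫⁻ x, f x ∂P) ^ T := by
  have hprod : Measurable fun z : Fin T → Ω => ∏ τ, f (z τ) := by fun_prop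
  refine (meas_ge_le_lintegral_div hprod.aemeasurable (ENNReal.ofReal_pos.2 (exp_pos _)).ne'
    ENNReal.ofReal_ne_top).trans_eq ?_
  rw [lintegral_fintype_prod_eq_prod _ fun _ => hf, Finset.prod_const, Finset.card_univ,
    Fintype.card_fin, mul_pow, ← ENNReal.ofReal_pow (exp_pos _).le, ← exp_nat_mul, mul_neg, exp_neg,
    ENNReal.ofReal_inv_of_pos (exp_pos _), div_eq_mul_inv, mul_comm]

end Chernoff

section LikelihoodRatio

open Real

variable {A B : Type*} [MeasurableSpace A] [MeasurableSpace B] (P : Measure (A × B))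

lemma measurable_likelihoodRatio : Measurable (likelihoodRatio P) :=
  (Measure.measurable_rnDeriv _ _).div (Measure.measurable_rnDeriv _ _)

lemma measurableSet_isTypical (γ : ℝ) (T : ℕ) :
    MeasurableSet {z : (Fin T → A) × (Fin T → B) | IsTypical P γ z.1 z.2} :=
  measurableSet_lt measurable_const (Finset.measurable_prod _ fun τ _ =>
    (measurable_likelihoodRatio P).comp (by fun_prop))

variable [IsProbabilityMeasure P]

lemma likelihoodRatio_ae_eq :
    likelihoodRatio P =ᵐ[P.fst.prod P.snd] P.rnDeriv (P.fst.prod P.snd) :=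
  (Measure.rnDeriv_eq_div_rnDeriv_add _ _).symm

lemma lintegral_likelihoodRatio_le : ∫⁻ z, likelihoodRatio P z ∂(P.fst.prod P.snd) ≤ 1 := by
  rw [lintegral_congr_ae (likelihoodRatio_ae_eq P)]
  exact Measure.lintegral_rnDeriv_le.trans_eq measure_univ

lemma likelihoodRatio_ae_ne_zero : ∀ᵐ z ∂P, likelihoodRatio P z ≠ 0 := by
  have hac : P ≪ P + P.fst.prod P.snd := Measure.AbsolutelyContinuous.rfl.add_right _
  filter_upwards [Measure.rnDeriv_pos hac,
    hac (Measure.rnDeriv_lt_top (P.fst.prod P.snd) (P + P.fst.prod P.snd))] with z hz hz'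
  exact ENNReal.div_ne_zero.2 ⟨hz.ne', hz'.ne⟩

lemma inv_likelihoodRatio_ae_eq :
    (fun z => (likelihoodRatio P z)⁻¹) =ᵐ[P] (P.fst.prod P.snd).rnDeriv P := by
  have hac : P ≪ P + P.fst.prod P.snd := Measure.AbsolutelyContinuous.rfl.add_right _
  have hdiv := Measure.rnDeriv_eq_div_rnDeriv_add (P.fst.prod P.snd) P
  rw [add_comm] at hdiv
  filter_upwards [hdiv, Measure.rnDeriv_pos hac, hac (Measure.rnDeriv_lt_top P _)]
    with z hz hz_pos hz_lt
  rw [hz, likelihoodRatio, ENNReal.inv_div (Or.inr hz_lt.ne) (Or.inr hz_pos.ne')]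

lemma exists_lintegral_inv_likelihoodRatio_rpow_lt_of_not_ac (hac : ¬ P ≪ P.fst.prod P.snd)
    (γ : ℝ) :
    ∃ s : ℝ, 0 < s ∧ ∫⁻ z, ((likelihoodRatio P z)⁻¹) ^ s ∂P < ENNReal.ofReal (exp (-(s * γ))) := by
  obtain ⟨E, hE, hQE, hPE⟩ :
      ∃ E, MeasurableSet E ∧ (P.fst.prod P.snd) E = 0 ∧ P E ≠ 0 := by
    by_contra! hcon
    exact hac (Measure.AbsolutelyContinuous.mk hcon)
  refine exists_lintegral_rpow_lt_of_ae_eq_zero (ρ := fun z => (likelihoodRatio P z)⁻¹)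
    (measurable_likelihoodRatio P).inv ?_ hE hPE ?_ γ
  · rw [lintegral_congr_ae (inv_likelihoodRatio_ae_eq P)]
    exact Measure.lintegral_rnDeriv_le.trans_eq measure_univ
  · have hzero : ∫⁻ z in E, (P.fst.prod P.snd).rnDeriv P z ∂P = 0 :=
      le_antisymm ((Measure.setLIntegral_rnDeriv_le E).trans_eq hQE) zero_le
    rw [setLIntegral_eq_zero_iff hE (Measure.measurable_rnDeriv _ _)] at hzero
    filter_upwards [hzero, inv_likelihoodRatio_ae_eq P] with z hz hz' hzE
    rw [hz', hz hzE]

lemma exists_lintegral_inv_likelihoodRatio_rpow_lt {γ : ℝ}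
    (hγ : ENNReal.ofReal γ < mutualInformation P) :
    ∃ s : ℝ, 0 < s ∧ ∫⁻ z, ((likelihoodRatio P z)⁻¹) ^ s ∂P < ENNReal.ofReal (exp (-(s * γ))) := by
  by_cases hac : P ≪ P.fst.prod P.snd
  · obtain ⟨s, hs, h⟩ := exists_lintegral_inv_rnDeriv_rpow_lt hac hγ
    refine ⟨s, hs, (lintegral_congr_ae ?_).trans_lt h⟩
    filter_upwards [hac (likelihoodRatio_ae_eq P)] with z hz
    rw [hz]
  · exact exists_lintegral_inv_likelihoodRatio_rpow_lt_of_not_ac P hac γ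

lemma pi_prod_isTypical_le (γ : ℝ) (T : ℕ) :
    (Measure.pi fun _ : Fin T => P.fst.prod P.snd)
      {z | IsTypical P γ (fun τ => (z τ).1) (fun τ => (z τ).2)} ≤
      ENNReal.ofReal (exp (-(T * γ))) := by
  calc (Measure.pi fun _ : Fin T => P.fst.prod P.snd)
        {z | IsTypical P γ (fun τ => (z τ).1) (fun τ => (z τ).2)}
      ≤ (ENNReal.ofReal (exp (-γ)) * ∫⁻ z, likelihoodRatio P z ∂(P.fst.prod P.snd)) ^ T :=
        (measure_mono fun _ (hz : IsTypical P γ _ _) => hz.le).trans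
          (pi_exp_le_prod_le (measurable_likelihoodRatio P) γ T)
    _ ≤ ENNReal.ofReal (exp (-γ)) ^ T := by
        gcongr
        exact mul_le_of_le_one_right zero_le (lintegral_likelihoodRatio_le P)
    _ = ENNReal.ofReal (exp (-(T * γ))) := by
        rw [← ENNReal.ofReal_pow (exp_pos _).le, ← exp_nat_mul, mul_neg]

lemma pi_not_isTypical_le (γ : ℝ) (T : ℕ) {s : ℝ} (hs : 0 ≤ s) :
    (Measure.pi fun _ : Fin T => P)
      {z | ¬ IsTypical P γ (fun τ => (z τ).1) (fun τ => (z τ).2)} ≤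
      (ENNReal.ofReal (exp (s * γ)) * ∫⁻ z, ((likelihoodRatio P z)⁻¹) ^ s ∂P) ^ T := by
  have hpow : ENNReal.ofReal (exp (T * -(s * γ))) = (ENNReal.ofReal (exp (T * γ)))⁻¹ ^ s := by
    rw [← ENNReal.ofReal_inv_of_pos (exp_pos _), ENNReal.ofReal_rpow_of_pos (by positivity),
      ← exp_neg, ← exp_mul]
    congr 2
    ring
  have hne : ∀ᵐ z ∂(Measure.pi fun _ : Fin T => P), ∀ τ, likelihoodRatio P (z τ) ≠ 0 :=
    eventually_all.2 fun τ => (Measure.tendsto_eval_ae_ae (μ := fun _ : Fin T => P)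
      (i := τ)).eventually (likelihoodRatio_ae_ne_zero P)
  rw [← neg_neg (s * γ)]
  refine (measure_mono_ae ?_).trans
    (pi_exp_le_prod_le ((measurable_likelihoodRatio P).inv.pow_const s) _ T)
  filter_upwards [hne] with z hz hzt
  change ENNReal.ofReal (exp (T * -(s * γ))) ≤ ∏ τ, ((likelihoodRatio P (z τ))⁻¹) ^ s
  rw [hpow, ENNReal.prod_rpow_of_nonneg hs,
    ← ENNReal.prod_inv_distrib fun i _ _ _ _ => Or.inl (hz i)]
  exact ENNReal.rpow_le_rpow (ENNReal.inv_le_inv.2 (not_lt.1 hzt)) hs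

end LikelihoodRatio

/-! ## Random codebooks -/

lemma map_compProd_comap_eq_prod_of_indepFun {Ω A B E : Type*} [MeasurableSpace Ω]
    [MeasurableSpace A] [MeasurableSpace B] [MeasurableSpace E] {μ : Measure Ω}
    [IsProbabilityMeasure μ] {f : Ω → A} {g : Ω → B} (h : IndepFun f g μ) (hf : Measurable f)
    (hg : Measurable g) (κ : Kernel B E) [IsMarkovKernel κ] :
    (μ ⊗ₘ κ.comap g hg).map (Prod.map f id) = (μ.map f).prod (κ ∘ₘ μ.map g) := by
  ext s hs
  have hF : Measurable fun z : A × B => κ z.2 (Prod.mk z.1 ⁻¹' s) :=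
    Kernel.measurable_kernel_prodMk_left (κ := κ.comap Prod.snd (measurable_snd (α := A)))
      (t := {w | (w.1.1, w.2) ∈ s}) (hs.preimage (by fun_prop))
  have : IsProbabilityMeasure (μ.map g) := Measure.isProbabilityMeasure_map hg.aemeasurable
  have hfid : Measurable (Prod.map f id : Ω × E → A × E) := hf.prodMap measurable_id
  calc (μ ⊗ₘ κ.comap g hg).map (Prod.map f id) s
      = ∫⁻ ω, κ (g ω) (Prod.mk (f ω) ⁻¹' s) ∂μ := by
        rw [Measure.map_apply hfid hs, Measure.compProd_apply (hfid hs)]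
        rfl
    _ = ∫⁻ z, κ z.2 (Prod.mk z.1 ⁻¹' s) ∂((μ.map f).prod (μ.map g)) := by
        rw [← (indepFun_iff_map_prod_eq_prod_map_map hf.aemeasurable hg.aemeasurable).1 h,
          lintegral_map hF (hf.prodMk hg)]
    _ = ∫⁻ a, (κ ∘ₘ μ.map g) (Prod.mk a ⁻¹' s) ∂(μ.map f) := by
        rw [lintegral_prod _ hF.aemeasurable]
        exact lintegral_congr fun a =>
          (Measure.bind_apply (measurable_prodMk_left hs) κ.aemeasurable).symm
    _ = ((μ.map f).prod (κ ∘ₘ μ.map g)) s := (Measure.prod_apply hs).symm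

lemma indepFun_eval_eval_pi_pi {ι : Type*} [Fintype ι] {κ : ι → Type*} [∀ i, Fintype (κ i)]
    {A : ι → Type*} [∀ i, MeasurableSpace (A i)] (ν : ∀ i, Measure (A i))
    [∀ i, IsProbabilityMeasure (ν i)] (w : ∀ i, κ i) {i : ι} {w' : κ i} (hw' : w' ≠ w i) :
    IndepFun (fun c : ∀ j, κ j → A j => c i w') (fun c j => c j (w j))
      (Measure.pi fun j => Measure.pi fun _ => ν j) := by
  classical
  have hindep : iIndepFun (fun (q : Σ j, κ j) (c : ∀ j, κ j → A j) => c q.1 q.2)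
      (Measure.pi fun j => Measure.pi fun _ => ν j) := by
    simpa only [Measure.infinitePi_eq_pi, id] using
      iIndepFun_uncurry_infinitePi (X := fun _ _ => id) (fun j (_ : κ j) => ν j)
        fun _ _ => measurable_id
  let sent : Finset (Σ j, κ j) := Finset.univ.image fun j => ⟨j, w j⟩
  have hdisj : Disjoint {⟨i, w'⟩} sent := by
    rw [Finset.disjoint_singleton_left, Finset.mem_image]
    rintro ⟨j, -, hj⟩
    obtain ⟨rfl, hj⟩ := Sigma.mk.inj_iff.1 hj
    exact hw' (eq_of_heq hj).symm
  have hblocks := hindep.indepFun_finset {⟨i, w'⟩} sent hdisj fun q => by fun_prop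
  have hunsent : Measurable fun x : ∀ q : ({⟨i, w'⟩} : Finset (Σ j, κ j)), A q.1.1 =>
      x ⟨⟨i, w'⟩, Finset.mem_singleton_self _⟩ := measurable_pi_apply _
  have hsent : Measurable fun (x : ∀ q : sent, A q.1.1) j =>
      x ⟨⟨j, w j⟩, Finset.mem_image_of_mem _ (Finset.mem_univ j)⟩ :=
    measurable_pi_lambda _ fun j => measurable_pi_apply _
  exact hblocks.comp hunsent hsent

lemma map_prod_pi_pi {ι : Type*} [Fintype ι] {A B : ι → Type*} [∀ i, MeasurableSpace (A i)]
    [∀ i, MeasurableSpace (B i)] (μ : ∀ i, Measure (A i)) (ν : ∀ i, Measure (B i))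
    [∀ i, IsProbabilityMeasure (μ i)] [∀ i, IsProbabilityMeasure (ν i)] :
    ((Measure.pi μ).prod (Measure.pi ν)).map (fun z i => (z.1 i, z.2 i)) =
      Measure.pi fun i => (μ i).prod (ν i) := by
  have hconst : piKernel (fun i => Kernel.const (A i) (ν i)) =
      Kernel.const (∀ i, A i) (Measure.pi ν) := rfl
  simp_rw [← Measure.compProd_const, ← hconst]
  exact map_pi_compProd_piKernel _ _

section Decoder

variable {A B : Type*} [MeasurableSpace A] [MeasurableSpace B] {P : Measure (A × B)} {γ : ℝ}
  {T M : ℕ} [NeZero M]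

lemma typicalityDecoder_eq_of_unique {cb : Fin M → Fin T → A} {y : Fin T → B} {w : Fin M}
    (hw : IsTypical P γ (cb w) y) (hne : ∀ w', w' ≠ w → ¬ IsTypical P γ (cb w') y) :
    typicalityDecoder P γ cb y = w := by
  have hex : ∃! w, IsTypical P γ (cb w) y :=
    ⟨w, hw, fun v hv => by_contra fun hvw => hne v hvw hv⟩
  rw [typicalityDecoder, dif_pos hex]
  exact hex.unique hex.choose_spec.1 hw

lemma typicalityDecoder_eq_iff {cb : Fin M → Fin T → A} {y : Fin T → B} {w : Fin M} :
    typicalityDecoder P γ cb y = w ↔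
      (IsTypical P γ (cb w) y ∧ ∀ v, IsTypical P γ (cb v) y → v = w) ∨
      (w = 0 ∧ ¬ ∃ u, IsTypical P γ (cb u) y ∧ ∀ v, IsTypical P γ (cb v) y → v = u) := by
  constructor
  · rintro rfl
    by_cases hex : ∃! w, IsTypical P γ (cb w) y
    · rw [typicalityDecoder, dif_pos hex]
      exact .inl hex.choose_spec
    · rw [typicalityDecoder, dif_neg hex]
      exact .inr ⟨rfl, hex⟩
  · rintro (⟨hw, hunique⟩ | ⟨rfl, hex⟩)
    · exact typicalityDecoder_eq_of_unique hw fun v hv hv' => hv (hunique v hv')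
    · exact dif_neg hex

variable (P γ)

lemma measurableSet_typicalityDecoder_eq (w : Fin M) :
    MeasurableSet {z : (Fin M → Fin T → A) × (Fin T → B) |
      typicalityDecoder P γ z.1 z.2 = w} := by
  have htyp (v : Fin M) : Measurable fun z : (Fin M → Fin T → A) × (Fin T → B) =>
      IsTypical P γ (z.1 v) z.2 :=
    measurableSet_setOfPred.1 ((measurableSet_isTypical P γ T).preimage
      (f := fun z : (Fin M → Fin T → A) × (Fin T → B) => (z.1 v, z.2)) (by fun_prop))
  have hunique (u : Fin M) : Measurable fun z : (Fin M → Fin T → A) × (Fin T → B) =>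
      IsTypical P γ (z.1 u) z.2 ∧ ∀ v, IsTypical P γ (z.1 v) z.2 → v = u :=
    (htyp u).and (.forall fun v => (htyp v).imp measurable_const)
  simp_rw [typicalityDecoder_eq_iff]
  exact measurableSet_setOfPred.2
    ((hunique w).or (measurable_const.and (Measurable.exists hunique).not))

lemma measurable_typicalityDecoder (cb : Fin M → Fin T → A) :
    Measurable (typicalityDecoder P γ cb : (Fin T → B) → Fin M) :=
  measurable_to_countable' fun w =>
    (measurableSet_typicalityDecoder_eq P γ w).preimage (measurable_prodMk_left (x := cb))

end Decoder

namespace ManyToOneChannel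

variable {n : ℕ} {X Y : Fin (n + 1) → Type*} {V : Type*}
  [∀ i, MeasurableSpace (X i)] [∀ i, MeasurableSpace (Y i)] [MeasurableSpace V]
  (C : ManyToOneChannel n X Y V) (p : ∀ i, ProbabilityMeasure (X i)) {T : ℕ}
  {M : Fin (n + 1) → ℕ} (w : ∀ j, Fin (M j))

instance : IsProbabilityMeasure (codebookLaw p T M) := by unfold codebookLaw; infer_instance

/-- The joint law of the random codebooks and of the outputs of all users when the messages `w`
are sent. -/
def transmissionLaw : Measure ((∀ j, Fin (M j) → Fin T → X j) × (Fin T → ∀ j, Y j)) :=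
  codebookLaw p T M ⊗ₘ
    (piKernel fun _ : Fin T => C.channel).comap (fun cb τ j => cb j (w j) τ) (by fun_prop)

lemma transmissionLaw_apply {s : Set ((∀ j, Fin (M j) → Fin T → X j) × (Fin T → ∀ j, Y j))}
    (hs : MeasurableSet s) :
    C.transmissionLaw p w s =
      ∫⁻ cb, (Measure.pi fun τ : Fin T => C.channel fun j => cb j (w j) τ) (Prod.mk cb ⁻¹' s)
        ∂(codebookLaw p T M) :=
  Measure.compProd_apply hs

lemma map_sent_codebookLaw :
    (codebookLaw p T M).map (fun cb τ j => cb j (w j) τ) =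
      Measure.pi fun _ : Fin T => Measure.pi fun j => (p j : Measure (X j)) := by
  have heval : (codebookLaw p T M).map (fun cb j => cb j (w j)) =
      Measure.pi fun j => Measure.pi fun _ : Fin T => (p j : Measure (X j)) :=
    (measurePreserving_pi _ _ fun j => measurePreserving_eval
      (fun _ : Fin (M j) => Measure.pi fun _ : Fin T => (p j : Measure (X j))) (w j)).map_eq
  rw [← map_pi_pi_swap fun j (_ : Fin T) => (p j : Measure (X j)), ← heval,
    Measure.map_map (by fun_prop) (by fun_prop)]
  rfl

lemma map_sent_transmissionLaw (i : Fin (n + 1)) :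
    (C.transmissionLaw p w).map (fun z τ => (z.1 i (w i) τ, z.2 τ i)) =
      Measure.pi fun _ : Fin T => C.userLaw p i := by
  have hsent : Measurable fun (cb : ∀ j, Fin (M j) → Fin T → X j) τ j => cb j (w j) τ := by
    fun_prop
  have hid : (C.transmissionLaw p w).map (Prod.map (fun cb τ j => cb j (w j) τ) id) =
      (Measure.pi fun _ : Fin T => Measure.pi fun j => (p j : Measure (X j))) ⊗ₘ
        piKernel fun _ : Fin T => C.channel := by
    rw [transmissionLaw, map_compProd_comap _ hsent, map_sent_codebookLaw]
  calc (C.transmissionLaw p w).map (fun z τ => (z.1 i (w i) τ, z.2 τ i))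
      = (((C.transmissionLaw p w).map (Prod.map (fun cb τ j => cb j (w j) τ) id)).map
          (fun z τ => (z.1 τ, z.2 τ))).map fun z τ => ((z τ).1 i, (z τ).2 i) := by
        rw [Measure.map_map (by fun_prop) (by fun_prop), Measure.map_map (by fun_prop)
          (by fun_prop)]
        rfl
    _ = Measure.pi fun _ : Fin T => C.userLaw p i := by
        rw [hid, map_pi_compProd_piKernel]
        have (_ : Fin T) : SigmaFinite (((Measure.pi fun j => (p j : Measure (X j))) ⊗ₘ
            C.channel).map fun z => (z.1 i, z.2 i)) :=
          inferInstanceAs (SigmaFinite (C.userLaw p i))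
        exact Measure.pi_map_pi (f := fun _ (z : (∀ j, X j) × ∀ j, Y j) => (z.1 i, z.2 i))
          fun _ => by fun_prop

lemma snd_userLaw (i : Fin (n + 1)) : (C.userLaw p i).snd =
    (C.channel ∘ₘ Measure.pi fun j => (p j : Measure (X j))).map (Function.eval i) := by
  rw [userLaw, Measure.snd_map_prodMk (by fun_prop), ← Measure.snd_compProd, Measure.snd,
    Measure.map_map (measurable_pi_apply i) measurable_snd]
  rfl

lemma map_unsent_transmissionLaw {i : Fin (n + 1)} {w' : Fin (M i)} (hw' : w' ≠ w i) :
    (C.transmissionLaw p w).map (fun z τ => (z.1 i w' τ, z.2 τ i)) =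
      Measure.pi fun _ : Fin T => (C.userLaw p i).fst.prod (C.userLaw p i).snd := by
  have hindep : IndepFun (fun cb => cb i w') (fun cb τ j => cb j (w j) τ) (codebookLaw p T M) :=
    (indepFun_eval_eval_pi_pi (fun j => Measure.pi fun _ : Fin T => (p j : Measure (X j))) w
      hw').comp measurable_id
      (ψ := fun (x : ∀ j, Fin T → X j) τ j => x j τ) (by fun_prop)
  have hunsent : (codebookLaw p T M).map (fun cb => cb i w') =
      Measure.pi fun _ : Fin T => (p i : Measure (X i)) :=
    ((measurePreserving_eval (fun _ : Fin (M i) => Measure.pi fun _ : Fin T =>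
      (p i : Measure (X i))) w').comp (measurePreserving_eval _ i)).map_eq
  have hid : (C.transmissionLaw p w).map (Prod.map (fun cb => cb i w') id) =
      (Measure.pi fun _ : Fin T => (p i : Measure (X i))).prod (Measure.pi fun _ : Fin T =>
        C.channel ∘ₘ Measure.pi fun j => (p j : Measure (X j))) := by
    rw [transmissionLaw, map_compProd_comap_eq_prod_of_indepFun hindep (by fun_prop) (by fun_prop),
      hunsent, map_sent_codebookLaw, piKernel_comp_pi]
  have houtput : (Measure.pi fun _ : Fin T =>
      C.channel ∘ₘ Measure.pi fun j => (p j : Measure (X j))).map (fun y τ => y τ i) =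
      Measure.pi fun _ : Fin T => (C.userLaw p i).snd := by
    simp_rw [snd_userLaw]
    have : IsProbabilityMeasure ((C.channel ∘ₘ Measure.pi fun j => (p j : Measure (X j))).map
      (Function.eval i)) := Measure.isProbabilityMeasure_map (measurable_pi_apply i).aemeasurable
    exact Measure.pi_map_pi fun τ => (measurable_pi_apply i).aemeasurable
  calc (C.transmissionLaw p w).map (fun z τ => (z.1 i w' τ, z.2 τ i))
      = (((C.transmissionLaw p w).map (Prod.map (fun cb => cb i w') id)).map
          (Prod.map id fun y τ => y τ i)).map fun z τ => (z.1 τ, z.2 τ) := by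
        rw [Measure.map_map (by fun_prop) (by fun_prop), Measure.map_map (by fun_prop)
          (by fun_prop)]
        rfl
    _ = Measure.pi fun _ : Fin T => (C.userLaw p i).fst.prod (C.userLaw p i).snd := by
        rw [hid, ← Measure.map_prod_map _ _ measurable_id (by fun_prop), Measure.map_id, houtput,
          map_prod_pi_pi, fst_userLaw]

section TypicalityDecoder

variable [∀ i, NeZero (M i)]

lemma transmissionLaw_typicalityDecoder_ne_le (γ : ℝ) (i : Fin (n + 1)) :
    C.transmissionLaw p w
        {z : (∀ j, Fin (M j) → Fin T → X j) × (Fin T → ∀ j, Y j) |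
          typicalityDecoder (C.userLaw p i) γ (z.1 i) (fun τ => z.2 τ i) ≠ w i} ≤
      (Measure.pi fun _ : Fin T => C.userLaw p i)
        {z | ¬ IsTypical (C.userLaw p i) γ (fun τ => (z τ).1) (fun τ => (z τ).2)} +
      (M i - 1 : ℕ) * (Measure.pi fun _ : Fin T => (C.userLaw p i).fst.prod (C.userLaw p i).snd)
        {z | IsTypical (C.userLaw p i) γ (fun τ => (z τ).1) (fun τ => (z τ).2)} := by
  have htyp : MeasurableSet {z : Fin T → X i × Y i |
      IsTypical (C.userLaw p i) γ (fun τ => (z τ).1) (fun τ => (z τ).2)} :=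
    (measurableSet_isTypical (C.userLaw p i) γ T).preimage
      (f := fun z : Fin T → X i × Y i => (fun τ => (z τ).1, fun τ => (z τ).2)) (by fun_prop)
  let pair (w' : Fin (M i)) (z : (∀ j, Fin (M j) → Fin T → X j) × (Fin T → ∀ j, Y j))
    (τ : Fin T) : X i × Y i := (z.1 i w' τ, z.2 τ i)
  have hpair (w' : Fin (M i)) : Measurable (pair w') := by fun_prop
  set typ := {z : Fin T → X i × Y i |
    IsTypical (C.userLaw p i) γ (fun τ => (z τ).1) (fun τ => (z τ).2)}
  calc _ ≤ C.transmissionLaw p w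
        (pair (w i) ⁻¹' typᶜ ∪ ⋃ w' ∈ Finset.univ.erase (w i), pair w' ⁻¹' typ) := by
        refine measure_mono fun z hz => ?_
        by_contra hcon
        rw [Set.mem_union, not_or] at hcon
        refine hz (typicalityDecoder_eq_of_unique (not_not.1 hcon.1) fun v hv hvtyp => hcon.2 ?_)
        exact Set.mem_biUnion (Finset.mem_erase.2 ⟨hv, Finset.mem_univ v⟩) hvtyp
    _ ≤ C.transmissionLaw p w (pair (w i) ⁻¹' typᶜ) +
        ∑ w' ∈ Finset.univ.erase (w i), C.transmissionLaw p w (pair w' ⁻¹' typ) :=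
        (measure_union_le _ _).trans (by gcongr; exact measure_biUnion_finset_le _ _)
    _ = (Measure.pi fun _ : Fin T => C.userLaw p i) typᶜ +
        ∑ _w' ∈ Finset.univ.erase (w i),
          (Measure.pi fun _ : Fin T => (C.userLaw p i).fst.prod (C.userLaw p i).snd) typ := by
        rw [← Measure.map_apply (hpair _) htyp.compl, C.map_sent_transmissionLaw p w i]
        congr 1
        refine Finset.sum_congr rfl fun w' hw' => ?_
        rw [← Measure.map_apply (hpair _) htyp,
          C.map_unsent_transmissionLaw p w (Finset.ne_of_mem_erase hw')]
    _ = _ := by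
        rw [Finset.sum_const, Finset.card_erase_of_mem (Finset.mem_univ _), Finset.card_univ,
          Fintype.card_fin, nsmul_eq_mul]
        rfl

lemma measurableSet_exists_typicalityDecoder_ne (γ : Fin (n + 1) → ℝ) :
    MeasurableSet {z : (∀ j, Fin (M j) → Fin T → X j) × (Fin T → ∀ j, Y j) |
      ∃ i, typicalityDecoder (C.userLaw p i) (γ i) (z.1 i) (fun τ => z.2 τ i) ≠ w i} := by
  rw [Set.ofPred_exists]
  exact .iUnion fun i => ((measurableSet_typicalityDecoder_eq (C.userLaw p i) (γ i) (w i)).preimage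
    (f := fun z : (∀ j, Fin (M j) → Fin T → X j) × (Fin T → ∀ j, Y j) =>
      (z.1 i, fun τ => z.2 τ i)) (by fun_prop)).compl

lemma measurable_pi_channel_typicalityDecoder (γ : Fin (n + 1) → ℝ) :
    Measurable fun cb : ∀ j, Fin (M j) → Fin T → X j =>
      (Measure.pi fun τ : Fin T => C.channel fun j => cb j (w j) τ)
        {y | ∃ i, typicalityDecoder (C.userLaw p i) (γ i) (cb i) (fun τ => y τ i) ≠ w i} :=
  Kernel.measurable_kernel_prodMk_left
    (κ := (piKernel fun _ : Fin T => C.channel).comap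
      (fun (cb : ∀ j, Fin (M j) → Fin T → X j) τ j => cb j (w j) τ) (by fun_prop))
    (C.measurableSet_exists_typicalityDecoder_ne p w γ)

lemma measurable_errorProb_typicalityDecoder (γ : Fin (n + 1) → ℝ) :
    Measurable fun cb : ∀ j, Fin (M j) → Fin T → X j =>
      C.errorProb cb (fun i => typicalityDecoder (C.userLaw p i) (γ i) (cb i)) :=
  (Finset.measurable_sum _ fun w _ =>
    C.measurable_pi_channel_typicalityDecoder p w γ).const_mul _

lemma lintegral_errorProb_typicalityDecoder_le (γ : Fin (n + 1) → ℝ) {a : Fin (n + 1) → ℝ≥0∞}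
    (ha : ∀ (w : ∀ j, Fin (M j)) i, C.transmissionLaw p w
      {z : (∀ j, Fin (M j) → Fin T → X j) × (Fin T → ∀ j, Y j) |
        typicalityDecoder (C.userLaw p i) (γ i) (z.1 i) (fun τ => z.2 τ i) ≠ w i} ≤ a i) :
    ∫⁻ cb, C.errorProb cb (fun i => typicalityDecoder (C.userLaw p i) (γ i) (cb i))
      ∂(codebookLaw p T M) ≤ ∑ i, a i := by
  have hprod : (∏ i, (M i : ℝ≥0∞)) ≠ 0 := Finset.prod_ne_zero_iff.2 fun i _ => by simp [NeZero.ne]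
  have hprod' : (∏ i, (M i : ℝ≥0∞)) ≠ ∞ := ENNReal.prod_ne_top fun i _ => by simp
  calc _ = (∏ i, (M i : ℝ≥0∞))⁻¹ * ∑ w : ∀ i, Fin (M i), C.transmissionLaw p w
        {z : (∀ j, Fin (M j) → Fin T → X j) × (Fin T → ∀ j, Y j) |
          ∃ i, typicalityDecoder (C.userLaw p i) (γ i) (z.1 i) (fun τ => z.2 τ i) ≠ w i} := by
        have hmeas (w : ∀ i, Fin (M i)) := C.measurable_pi_channel_typicalityDecoder (T := T) p w γ
        simp_rw [errorProb]
        rw [lintegral_const_mul _ (Finset.measurable_sum _ fun w _ => hmeas w),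
          lintegral_finsetSum _ fun w _ => hmeas w]
        congr with w
        rw [transmissionLaw_apply _ _ _ (C.measurableSet_exists_typicalityDecoder_ne p w γ)]
        rfl
    _ ≤ (∏ i, (M i : ℝ≥0∞))⁻¹ * ∑ w : ∀ i, Fin (M i), ∑ i, C.transmissionLaw p w
        {z : (∀ j, Fin (M j) → Fin T → X j) × (Fin T → ∀ j, Y j) |
          typicalityDecoder (C.userLaw p i) (γ i) (z.1 i) (fun τ => z.2 τ i) ≠ w i} := by
        gcongr with w
        rw [Set.ofPred_exists]
        exact measure_iUnion_fintype_le _ _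
    _ ≤ ∑ i, a i := by
        refine (ENNReal.inv_mul_le_iff hprod hprod').2 ?_
        refine (Finset.sum_le_card_nsmul _ _ _ fun w _ => Finset.sum_le_sum fun i _ =>
          ha w i).trans_eq ?_
        simp only [Finset.card_univ, Fintype.card_pi, Fintype.card_fin, nsmul_eq_mul, Nat.cast_prod]

end TypicalityDecoder

end ManyToOneChannel

/-! ## Achievability -/

lemma messageCount_zero (T : ℕ) : messageCount 0 T = 1 := by simp [messageCount]

lemma messageCount_sub_one_le (R : ℝ) (T : ℕ) :
    ((messageCount R T - 1 : ℕ) : ℝ≥0∞) ≤ ENNReal.ofReal (Real.exp (T * R)) := by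
  rw [← ENNReal.ofReal_natCast, Nat.cast_sub NeZero.one_le, Nat.cast_one]
  exact ENNReal.ofReal_le_ofReal
    (sub_le_iff_le_add.2 (Nat.ceil_lt_add_one (Real.exp_pos _).le).le)

lemma le_log_messageCount_div (R : ℝ) {T : ℕ} (hT : 0 < T) :
    R ≤ Real.log (messageCount R T) / T := by
  have hT' : (0 : ℝ) < T := Nat.cast_pos.2 hT
  rw [le_div_iff₀ hT', mul_comm, Real.le_log_iff_exp_le (Nat.cast_pos.2 (NeZero.pos _))]
  exact Nat.le_ceil _

lemma log_messageCount_div_le {R : ℝ} (hR : 0 ≤ R) {T : ℕ} (hT : 0 < T) :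
    Real.log (messageCount R T) / T ≤ R + 1 / T := by
  have hT' : (0 : ℝ) < T := Nat.cast_pos.2 hT
  have hexp : (1 : ℝ) ≤ Real.exp (T * R) := Real.one_le_exp (by positivity)
  rw [div_le_iff₀ hT', Real.log_le_iff_le_exp (Nat.cast_pos.2 (NeZero.pos _))]
  calc (messageCount R T : ℝ) ≤ Real.exp (T * R) + 1 :=
        (Nat.ceil_lt_add_one (Real.exp_pos _).le).le
    _ ≤ Real.exp (T * R) * 2 := by linarith
    _ ≤ Real.exp (T * R) * Real.exp 1 := by
        gcongr
        linarith [Real.add_one_le_exp (1 : ℝ)]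
    _ = Real.exp ((R + 1 / T) * T) := by
        rw [← Real.exp_add]
        congr 1
        field_simp

lemma tendsto_log_messageCount_div {R : ℝ} (hR : 0 ≤ R) :
    Tendsto (fun T : ℕ => Real.log (messageCount R T) / T) atTop (𝓝 R) := by
  have h : Tendsto (fun T : ℕ => R + 1 / (T : ℝ)) atTop (𝓝 R) := by
    simpa using tendsto_const_nhds.add (tendsto_one_div_atTop_nhds_zero_nat (𝕜 := ℝ))
  refine tendsto_of_tendsto_of_tendsto_of_le_of_le' tendsto_const_nhds h ?_ ?_
  · filter_upwards [eventually_gt_atTop 0] with T hT using le_log_messageCount_div R hT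
  · filter_upwards [eventually_gt_atTop 0] with T hT using log_messageCount_div_le hR hT

lemma messageCount_log_div {m t : ℕ} (hm : 0 < m) (ht : 0 < t) (k : ℕ) :
    messageCount (Real.log m / t) (k * t) = m ^ k := by
  have hexponent : ((k * t : ℕ) : ℝ) * (Real.log m / t) = k * Real.log m := by
    have : (t : ℝ) ≠ 0 := Nat.cast_ne_zero.2 ht.ne'
    push_cast
    field_simp
  rw [messageCount, hexponent, Real.exp_nat_mul, Real.exp_log (Nat.cast_pos.2 hm), ← Nat.cast_pow,
    Nat.ceil_natCast]

lemma exists_seq_ofReal_lt_tendsto (I : ℝ≥0∞) : ∃ r : ℕ → ℝ,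
    (∀ k, 0 ≤ r k ∧ (r k = 0 ∨ ENNReal.ofReal (r k) < I)) ∧
      Tendsto (fun k => ENNReal.ofReal (r k)) atTop (𝓝 I) := by
  rcases eq_or_ne I 0 with rfl | hI
  · exact ⟨fun _ => 0, fun _ => ⟨le_rfl, .inl rfl⟩, by simp⟩
  obtain ⟨u, -, hu, hlim⟩ := exists_seq_strictMono_tendsto' (pos_iff_ne_zero.2 hI)
  have hofReal (k : ℕ) : ENNReal.ofReal (u k).toReal = u k :=
    ENNReal.ofReal_toReal (hu k).2.ne_top
  exact ⟨fun k => (u k).toReal,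
    fun k => ⟨ENNReal.toReal_nonneg, .inr ((hofReal k).trans_lt (hu k).2)⟩,
    by simpa only [hofReal] using hlim⟩

lemma exists_tendsto_typicality_error {A B : Type*} [MeasurableSpace A] [MeasurableSpace B]
    (P : Measure (A × B)) [IsProbabilityMeasure P] {R : ℝ} (hR : 0 ≤ R)
    (hRP : ENNReal.ofReal R < mutualInformation P) :
    ∃ γ, Tendsto (fun T : ℕ =>
      (Measure.pi fun _ : Fin T => P)
          {z | ¬ IsTypical P γ (fun τ => (z τ).1) (fun τ => (z τ).2)} +
        (messageCount R T - 1 : ℕ) * (Measure.pi fun _ : Fin T => P.fst.prod P.snd)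
          {z | IsTypical P γ (fun τ => (z τ).1) (fun τ => (z τ).2)}) atTop (𝓝 0) := by
  obtain ⟨γ, -, hγR, hγP⟩ := ENNReal.lt_iff_exists_real_btwn.1 hRP
  have hγ : R < γ := (ENNReal.ofReal_lt_ofReal_iff_of_nonneg hR).1 hγR
  obtain ⟨s, hs, hsP⟩ := exists_lintegral_inv_likelihoodRatio_rpow_lt P hγP
  let miss := ENNReal.ofReal (Real.exp (s * γ)) * ∫⁻ z, ((likelihoodRatio P z)⁻¹) ^ s ∂P
  let confuse := ENNReal.ofReal (Real.exp (R - γ))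
  have hmiss : miss < 1 := by
    have hexp : ENNReal.ofReal (Real.exp (s * γ)) ≠ 0 := by simp [Real.exp_pos]
    calc miss < ENNReal.ofReal (Real.exp (s * γ)) * ENNReal.ofReal (Real.exp (-(s * γ))) :=
          (ENNReal.mul_lt_mul_iff_right hexp ENNReal.ofReal_ne_top).2 hsP
      _ = 1 := by
          rw [← ENNReal.ofReal_mul (Real.exp_pos _).le, ← Real.exp_add, add_neg_cancel,
            Real.exp_zero, ENNReal.ofReal_one]
  have hconfuse : confuse < 1 := by
    rw [ENNReal.ofReal_lt_one, Real.exp_lt_one_iff]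
    exact sub_neg.2 hγ
  have hlim : Tendsto (fun T : ℕ => miss ^ T + confuse ^ T) atTop (𝓝 0) := by
    simpa using (ENNReal.tendsto_pow_atTop_nhds_zero_of_lt_one hmiss).add
      (ENNReal.tendsto_pow_atTop_nhds_zero_of_lt_one hconfuse)
  refine ⟨γ, tendsto_of_tendsto_of_tendsto_of_le_of_le tendsto_const_nhds hlim
    (fun _ => zero_le) fun T => add_le_add (pi_not_isTypical_le P γ T hs.le) ?_⟩
  refine (mul_le_mul' (messageCount_sub_one_le R T) (pi_prod_isTypical_le P γ T)).trans_eq ?_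
  rw [← ENNReal.ofReal_mul (Real.exp_pos _).le, ← Real.exp_add,
    ← ENNReal.ofReal_pow (Real.exp_pos _).le, ← Real.exp_nat_mul]
  ring_nf

namespace ManyToOneChannel

variable {n : ℕ} {X Y : Fin (n + 1) → Type*} {V : Type*}
  [∀ i, MeasurableSpace (X i)] [∀ i, MeasurableSpace (Y i)] [MeasurableSpace V]
  (C : ManyToOneChannel n X Y V) {p : ∀ i, ProbabilityMeasure (X i)} {R : Fin (n + 1) → ℝ}

/-- The rate conditions under which random coding with input laws `p` is reliable: every rate is
`0` or below the single-letter mutual information of its user. The rate `0` is allowed separately,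
as the mutual information may vanish. -/
def IsBelowUserInfo (p : ∀ i, ProbabilityMeasure (X i)) (R : Fin (n + 1) → ℝ) : Prop :=
  ∀ i, 0 ≤ R i ∧ (R i = 0 ∨ ENNReal.ofReal (R i) < C.userInfo p i)

variable {C}

lemma IsBelowUserInfo.exists_threshold (hR : C.IsBelowUserInfo p R) (i : Fin (n + 1)) :
    ∃ (γ : ℝ) (a : ℕ → ℝ≥0∞), Tendsto a atTop (𝓝 0) ∧
      ∀ (T : ℕ) (w : ∀ j, Fin (messageCount (R j) T)), C.transmissionLaw p w
        {z : (∀ j, Fin (messageCount (R j) T) → Fin T → X j) × (Fin T → ∀ j, Y j) |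
          typicalityDecoder (C.userLaw p i) γ (z.1 i) (fun τ => z.2 τ i) ≠ w i} ≤ a T := by
  obtain ⟨hnonneg, hzero | hlt⟩ := hR i
  · refine ⟨0, fun _ => 0, tendsto_const_nhds, fun T w => ?_⟩
    have : Subsingleton (Fin (messageCount (R i) T)) := by
      rw [hzero, messageCount_zero]
      infer_instance
    simp only [ne_eq, Subsingleton.elim _ (w i), not_true_eq_false, Set.ofPred_false,
      measure_empty, le_refl]
  · obtain ⟨γ, hγ⟩ := exists_tendsto_typicality_error (C.userLaw p i) hnonneg hlt
    exact ⟨γ, _, hγ, fun T w => C.transmissionLaw_typicalityDecoder_ne_le p w γ i⟩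

theorem IsBelowUserInfo.randomCodingAchieves (hR : C.IsBelowUserInfo p R) :
    C.RandomCodingAchieves p R := by
  choose γ a ha herror using hR.exists_threshold
  have hlim : Tendsto (fun T => ∑ i, a i T) atTop (𝓝 0) := by
    simpa using tendsto_finsetSum Finset.univ fun i _ => ha i
  exact ⟨fun i => (hR i).1, γ, tendsto_of_tendsto_of_tendsto_of_le_of_le tendsto_const_nhds hlim
    (fun _ => zero_le) fun T => C.lintegral_errorProb_typicalityDecoder_le p γ
      fun w i => herror i T w⟩

lemma RandomCodingAchieves.exists_codes (h : C.RandomCodingAchieves p R) :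
    ∃ (enc : ∀ (T : ℕ) i, Fin (messageCount (R i) T) → Fin T → X i)
      (dec : ∀ (T : ℕ) i, (Fin T → Y i) → Fin (messageCount (R i) T)),
      (∀ T i, Measurable (dec T i)) ∧
      Tendsto (fun T => C.errorProb (enc T) (dec T)) atTop (𝓝 0) := by
  obtain ⟨-, γ, hγ⟩ := h
  have hex (T : ℕ) := exists_le_lintegral (μ := codebookLaw p T fun i => messageCount (R i) T)
    (C.measurable_errorProb_typicalityDecoder p γ).aemeasurable
  choose enc henc using hex
  refine ⟨enc, fun T i => typicalityDecoder (C.userLaw p i) (γ i) (enc T i), fun T i => ?_,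
    tendsto_of_tendsto_of_tendsto_of_le_of_le tendsto_const_nhds hγ (fun _ => zero_le) henc⟩
  exact measurable_typicalityDecoder _ _ _

lemma RandomCodingAchieves.sum_rate_le (hC : C.IsDegraded) {S : ℝ≥0∞}
    (hI : ∀ p : ∀ i, ProbabilityMeasure (X i), ∑ i, C.userInfo p i ≤ S)
    (h : C.RandomCodingAchieves p R) : ENNReal.ofReal (∑ i, R i) ≤ S := by
  obtain ⟨enc, dec, hdec, hlim⟩ := h.exists_codes
  exact C.sum_rate_le hC hI (T := fun k => k + 1) (fun k => enc (k + 1)) (fun k => dec (k + 1))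
    (fun k => k.succ_pos) (fun k i => NeZero.pos _) (fun k => hdec (k + 1))
    (fun k i => le_log_messageCount_div _ k.succ_pos) (hlim.comp (tendsto_add_atTop_nat 1))

lemma RandomCodingAchieves.achievable {m : Fin (n + 1) → ℕ} (hm : ∀ i, 0 < m i) {t : ℕ}
    (ht : 0 < t) (h : C.RandomCodingAchieves p fun i => Real.log (m i) / t) :
    C.Achievable fun i => Real.log (m i) / t := by
  obtain ⟨enc, dec, hdec, hlim⟩ := h.exists_codes
  refine ⟨fun k => (k + 1) * t, fun k i => messageCount (Real.log (m i) / t) ((k + 1) * t),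
    fun k => enc ((k + 1) * t), fun k => dec ((k + 1) * t), fun k => by positivity,
    fun k i => NeZero.pos _, fun k => hdec _, fun k i => ?_, hlim.comp ?_⟩
  · beta_reduce
    rw [messageCount_log_div (hm i) ht]
    have : (t : ℝ) ≠ 0 := Nat.cast_ne_zero.2 ht.ne'
    have : ((k + 1 : ℕ) : ℝ) ≠ 0 := Nat.cast_ne_zero.2 k.succ_ne_zero
    rw [Nat.cast_pow, Real.log_pow, Nat.cast_mul]
    field_simp
  · exact tendsto_atTop_mono (fun k => (Nat.le_succ k).trans (Nat.le_mul_of_pos_right _ ht))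
      tendsto_id

lemma IsBelowUserInfo.eventually_log_messageCount_div (hR : C.IsBelowUserInfo p R) :
    ∀ᶠ T : ℕ in atTop, C.IsBelowUserInfo p fun i => Real.log (messageCount (R i) T) / T := by
  refine eventually_all.2 fun i => ?_
  obtain ⟨hnonneg, hzero | hlt⟩ := hR i
  · exact Eventually.of_forall fun T => by simp [hzero, messageCount_zero]
  · filter_upwards [((ENNReal.continuous_ofReal.tendsto _).comp
      (tendsto_log_messageCount_div hnonneg)).eventually_lt_const hlt] with T hT
    exact ⟨div_nonneg (Real.log_nonneg (Nat.one_le_cast.2 NeZero.one_le)) (Nat.cast_nonneg _),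
      .inr hT⟩

theorem IsBelowUserInfo.mem_capacityRegion (hR : C.IsBelowUserInfo p R) :
    R ∈ C.capacityRegion := by
  refine mem_closure_of_tendsto (b := atTop)
    (tendsto_pi_nhds.2 fun i => tendsto_log_messageCount_div (hR i).1) ?_
  filter_upwards [hR.eventually_log_messageCount_div, eventually_gt_atTop 0] with T hT hT0
  exact hT.randomCodingAchieves.achievable (fun i => NeZero.pos _) hT0

variable (C)

lemma exists_seq_isBelowUserInfo (p : ∀ i, ProbabilityMeasure (X i)) :
    ∃ R : ℕ → Fin (n + 1) → ℝ, (∀ k, C.IsBelowUserInfo p (R k)) ∧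
      ∀ i, Tendsto (fun k => ENNReal.ofReal (R k i)) atTop (𝓝 (C.userInfo p i)) := by
  choose r hr hlim using fun i => exists_seq_ofReal_lt_tendsto (C.userInfo p i)
  exact ⟨fun k i => r i k, fun k i => hr i k, hlim⟩

lemma sum_userInfo_le {S : ℝ≥0∞}
    (hS : ∀ R, C.IsBelowUserInfo p R → ENNReal.ofReal (∑ i, R i) ≤ S) :
    ∑ i, C.userInfo p i ≤ S := by
  obtain ⟨R, hR, hlim⟩ := C.exists_seq_isBelowUserInfo p
  refine le_of_tendsto' (tendsto_finsetSum Finset.univ fun i _ => hlim i) fun k => ?_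
  rw [← ENNReal.ofReal_sum_of_nonneg fun i _ => (hR k i).1]
  exact hS _ (hR k)

lemma toReal_userInfo_mem_capacityRegion (hp : ∀ i, C.userInfo p i ≠ ∞) :
    (fun i => (C.userInfo p i).toReal) ∈ C.capacityRegion := by
  obtain ⟨R, hR, hlim⟩ := C.exists_seq_isBelowUserInfo p
  refine isClosed_closure.mem_of_tendsto (b := atTop) (f := R) (tendsto_pi_nhds.2 fun i => ?_)
    (Eventually.of_forall fun k => (hR k).mem_capacityRegion)
  exact ((ENNReal.tendsto_toReal (hp i)).comp (hlim i)).congr fun k =>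
    ENNReal.toReal_ofReal (hR k i).1

theorem sumCapacity_eq (hC : C.IsDegraded) :
    C.sumCapacity = ⨆ p : ∀ i, ProbabilityMeasure (X i), ∑ i, C.userInfo p i := by
  refine le_antisymm (iSup₂_le fun R hR => C.sum_rate_le_of_mem_capacityRegion hC
    (le_iSup fun p => ∑ i, C.userInfo p i) hR) (iSup_le fun p => C.sum_userInfo_le fun R hR => ?_)
  exact le_iSup₂ (f := fun R (_ : R ∈ C.capacityRegion) => ENNReal.ofReal (∑ i, R i)) R
    hR.mem_capacityRegion

theorem sumCapacity_eq_iSup_randomCoding (hC : C.IsDegraded) :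
    C.sumCapacity = ⨆ (p : ∀ i, ProbabilityMeasure (X i)) (R : Fin (n + 1) → ℝ)
      (_ : C.RandomCodingAchieves p R), ENNReal.ofReal (∑ i, R i) := by
  rw [C.sumCapacity_eq hC]
  refine le_antisymm (iSup_mono fun p => C.sum_userInfo_le fun R hR => ?_)
    (iSup_le fun p => iSup₂_le fun R hR => hR.sum_rate_le hC
      (le_iSup fun p => ∑ i, C.userInfo p i))
  exact le_iSup₂ (f := fun R (_ : C.RandomCodingAchieves p R) => ENNReal.ofReal (∑ i, R i)) R
    hR.randomCodingAchieves

theorem isGreatest_sum_capacityRegion (hC : C.IsDegraded)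
    (hp : ∀ p' : ∀ i, ProbabilityMeasure (X i), ∑ i, C.userInfo p' i ≤ ∑ i, C.userInfo p i)
    (hfin : ∑ i, C.userInfo p i ≠ ∞) :
    IsGreatest ((fun R : Fin (n + 1) → ℝ => ∑ i, R i) '' C.capacityRegion)
      (∑ i, C.userInfo p i).toReal := by
  have hfin' (i) : C.userInfo p i ≠ ∞ := ENNReal.sum_ne_top.1 hfin i (Finset.mem_univ i)
  refine ⟨⟨_, C.toReal_userInfo_mem_capacityRegion hfin', ?_⟩, ?_⟩
  · exact (ENNReal.toReal_sum fun i _ => hfin' i).symm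
  · rintro _ ⟨R, hR, rfl⟩
    exact (ENNReal.ofReal_le_iff_le_toReal hfin).1
      (C.sum_rate_le_of_mem_capacityRegion hC hp hR)

end ManyToOneChannel

/-! ## Finite alphabets -/

section Mixture

open InformationTheory

variable {Z : Type*} [MeasurableSpace Z] {ρ : Measure Z} [IsProbabilityMeasure ρ]

lemma exists_density_of_le_smul {ν : Measure Z} {c : ℝ≥0∞} (hc : c ≠ ∞) (hν : ν ≤ c • ρ) :
    ∃ w : Z → ℝ, Measurable w ∧ (∀ z, w z ∈ Set.Icc 0 c.toReal) ∧
      ν = ρ.withDensity fun z => ENNReal.ofReal (w z) := by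
  have hfin : IsFiniteMeasure ν := ⟨(hν Set.univ).trans_lt (by simp [hc.lt_top])⟩
  have hac : ν ≪ ρ := (Measure.absolutelyContinuous_of_le hν).trans
    Measure.smul_absolutelyContinuous
  have hle : ν.rnDeriv ρ ≤ᵐ[ρ] fun _ => c := by
    refine ae_le_of_forall_setLIntegral_le_of_sigmaFinite (Measure.measurable_rnDeriv _ _)
      fun s _ _ => ?_
    rw [Measure.setLIntegral_rnDeriv hac, setLIntegral_const]
    exact hν s
  refine ⟨fun z => (min (ν.rnDeriv ρ z) c).toReal,
    ((Measure.measurable_rnDeriv _ _).min measurable_const).ennreal_toReal,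
    fun z => ⟨ENNReal.toReal_nonneg, ENNReal.toReal_mono hc (min_le_right _ _)⟩, ?_⟩
  refine (Measure.withDensity_rnDeriv_eq ν ρ hac).symm.trans (withDensity_congr_ae ?_)
  filter_upwards [hle] with z hz
  rw [min_eq_left hz, ENNReal.ofReal_toReal (ne_top_of_le_ne_top hc hz)]

lemma withDensity_sum_mul {Ξ : Type*} [Fintype Ξ] (μ : Measure Z) {g : Ξ → ℝ} (hg : ∀ x, 0 ≤ g x)
    {w : Ξ → Z → ℝ} (hw : ∀ x, Measurable (w x)) (hw₀ : ∀ x z, 0 ≤ w x z) :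
    μ.withDensity (fun z => ENNReal.ofReal (∑ x, g x * w x z)) =
      ∑ x, ENNReal.ofReal (g x) • μ.withDensity fun z => ENNReal.ofReal (w x z) := by
  have hsum (z : Z) : ENNReal.ofReal (∑ x, g x * w x z) =
      ∑ x, ENNReal.ofReal (g x) * ENNReal.ofReal (w x z) := by
    rw [ENNReal.ofReal_sum_of_nonneg fun x _ => mul_nonneg (hg x) (hw₀ x z)]
    exact Finset.sum_congr rfl fun x _ => ENNReal.ofReal_mul (hg x)
  ext s hs
  simp_rw [withDensity_apply _ hs, hsum, Measure.finsetSum_apply, Measure.smul_apply,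
    withDensity_apply _ hs, smul_eq_mul]
  rw [lintegral_finsetSum _ fun x _ => (hw x).ennreal_ofReal.const_mul _]
  exact Finset.sum_congr rfl fun x _ => lintegral_const_mul _ (hw x).ennreal_ofReal

variable {Θ : Type*} [TopologicalSpace Θ] [FirstCountableTopology Θ]

lemma klDiv_ne_top_and_continuous_of_density {Q : Θ → Measure Z} [∀ θ, IsProbabilityMeasure (Q θ)]
    {u : Θ → Z → ℝ} {c : ℝ} (hu : ∀ θ, Measurable (u θ)) (hu_mem : ∀ θ z, u θ z ∈ Set.Icc 0 c)
    (hu_cont : ∀ z, Continuous fun θ => u θ z)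
    (hQ : ∀ θ, Q θ = ρ.withDensity fun z => ENNReal.ofReal (u θ z)) :
    (∀ θ, klDiv (Q θ) ρ ≠ ∞) ∧ Continuous fun θ => (klDiv (Q θ) ρ).toReal := by
  have hac (θ : Θ) : Q θ ≪ ρ := by rw [hQ]; exact withDensity_absolutelyContinuous _ _
  have hklFun (θ : Θ) : (fun z => klFun ((Q θ).rnDeriv ρ z).toReal) =ᵐ[ρ]
      fun z => klFun (u θ z) := by
    have hdensity := Measure.rnDeriv_withDensity ρ (hu θ).ennreal_ofReal
    rw [← hQ] at hdensity
    filter_upwards [hdensity] with z hz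
    rw [hz, ENNReal.toReal_ofReal (hu_mem θ z).1]
  obtain ⟨D, hD⟩ := (isCompact_Icc (a := (0 : ℝ)) (b := c)).exists_bound_of_continuousOn
    continuous_klFun.continuousOn
  have hint (θ : Θ) : Integrable (fun z => klFun (u θ z)) ρ :=
    .of_bound (continuous_klFun.measurable.comp (hu θ)).aestronglyMeasurable D
      (.of_forall fun z => hD _ (hu_mem θ z))
  refine ⟨fun θ => klDiv_ne_top (hac θ) ((integrable_klFun_rnDeriv_iff (hac θ)).1
    ((hint θ).congr (hklFun θ).symm)), ?_⟩
  have hintegral (θ : Θ) : (klDiv (Q θ) ρ).toReal = ∫ z, klFun (u θ z) ∂ρ := by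
    rw [toReal_klDiv_eq_integral_klFun (hac θ), integral_congr_ae (hklFun θ)]
  simp_rw [hintegral]
  exact continuous_of_dominated (fun θ => (hint θ).aestronglyMeasurable)
    (fun θ => .of_forall fun z => hD _ (hu_mem θ z)) (integrable_const D)
    (.of_forall fun z => continuous_klFun.comp (hu_cont z))

variable {Ξ : Type*} [Fintype Ξ] {c : Ξ → ℝ≥0∞} {g : Θ → Ξ → ℝ}

lemma klDiv_ne_top_and_continuous_mixture {ν : Ξ → Measure Z} (hc : ∀ x, c x ≠ ∞)
    (hν : ∀ x, ν x ≤ c x • ρ) (hg : ∀ x, Continuous fun θ => g θ x)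
    (hg_mem : ∀ θ x, g θ x ∈ Set.Icc 0 1) (Q : Θ → Measure Z) [∀ θ, IsProbabilityMeasure (Q θ)]
    (hQ : ∀ θ, Q θ = ∑ x, ENNReal.ofReal (g θ x) • ν x) :
    (∀ θ, klDiv (Q θ) ρ ≠ ∞) ∧ Continuous fun θ => (klDiv (Q θ) ρ).toReal := by
  choose w hw hw_mem hwν using fun x => exists_density_of_le_smul (hc x) (hν x)
  refine klDiv_ne_top_and_continuous_of_density (u := fun θ z => ∑ x, g θ x * w x z)
    (c := ∑ x, (c x).toReal) (fun θ => Finset.measurable_sum _ fun x _ => (hw x).const_mul _)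
    (fun θ z => ⟨Finset.sum_nonneg fun x _ => mul_nonneg (hg_mem θ x).1 (hw_mem x z).1,
      Finset.sum_le_sum fun x _ => ?_⟩)
    (fun z => continuous_finsetSum _ fun x _ => (hg x).mul_const _) fun θ => ?_
  · exact (mul_le_of_le_one_left (hw_mem x z).1 (hg_mem θ x).2).trans (hw_mem x z).2
  · rw [withDensity_sum_mul ρ (fun x => (hg_mem θ x).1) hw fun x z => (hw_mem x z).1, hQ]
    simp_rw [← hwν]

lemma mutualInformation_ne_top_and_continuous_mixture {A B : Type*} [MeasurableSpace A]
    [MeasurableSpace B] {a : Measure A} [IsProbabilityMeasure a] {b : Measure B}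
    [IsProbabilityMeasure b] {ν : Ξ → Measure (A × B)} (hc : ∀ x, c x ≠ ∞)
    (hν : ∀ x, ν x ≤ c x • a.prod b) (hg : ∀ x, Continuous fun θ => g θ x)
    (hg_mem : ∀ θ x, g θ x ∈ Set.Icc 0 1) (P : Θ → Measure (A × B))
    [∀ θ, IsProbabilityMeasure (P θ)] (hP : ∀ θ, P θ = ∑ x, ENNReal.ofReal (g θ x) • ν x) :
    (∀ θ, mutualInformation (P θ) ≠ ∞) ∧ Continuous fun θ => (mutualInformation (P θ)).toReal := by
  have hfst (θ : Θ) : (P θ).fst = ∑ x, ENNReal.ofReal (g θ x) • (ν x).fst := by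
    ext s hs
    simp_rw [Measure.fst_apply hs, hP, Measure.finsetSum_apply, Measure.smul_apply,
      Measure.fst_apply hs]
  have hsnd (θ : Θ) : (P θ).snd = ∑ x, ENNReal.ofReal (g θ x) • (ν x).snd := by
    ext s hs
    simp_rw [Measure.snd_apply hs, hP, Measure.finsetSum_apply, Measure.smul_apply,
      Measure.snd_apply hs]
  have hνfst (x : Ξ) : (ν x).fst ≤ c x • a := by
    have hmap := Measure.map_mono (hν x) measurable_fst
    rwa [Measure.map_smul, ← Measure.fst, ← Measure.fst, Measure.fst_prod] at hmap
  have hνsnd (x : Ξ) : (ν x).snd ≤ c x • b := by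
    have hmap := Measure.map_mono (hν x) measurable_snd
    rwa [Measure.map_smul, ← Measure.snd, ← Measure.snd, Measure.snd_prod] at hmap
  obtain ⟨hfin, hcont⟩ := klDiv_ne_top_and_continuous_mixture hc hν hg hg_mem P hP
  obtain ⟨hfin₁, hcont₁⟩ := klDiv_ne_top_and_continuous_mixture hc hνfst hg hg_mem
    (fun θ => (P θ).fst) hfst
  obtain ⟨hfin₂, hcont₂⟩ := klDiv_ne_top_and_continuous_mixture hc hνsnd hg hg_mem
    (fun θ => (P θ).snd) hsnd
  have hI (θ : Θ) := mutualInformation_ne_top_of_klDiv_prod_ne_top (hfin θ)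
  refine ⟨hI, (hcont.sub (hcont₁.add hcont₂)).congr fun θ => ?_⟩
  simp only [Pi.sub_apply, Pi.add_apply]
  rw [klDiv_prod_eq_mutualInformation_add, ENNReal.toReal_add (hI θ) (by simp [hfin₁, hfin₂]),
    ENNReal.toReal_add (hfin₁ θ) (hfin₂ θ), add_sub_cancel_right]

end Mixture

section Simplex

variable {A : Type*} [Fintype A] [MeasurableSpace A]

/-- The probability measure on a finite type given by a point of the standard simplex. -/
def simplexMeasure (θ : stdSimplex ℝ A) : ProbabilityMeasure A :=
  ⟨∑ a, ENNReal.ofReal (θ.1 a) • Measure.dirac a, ⟨by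
    rw [Measure.finsetSum_apply]
    simp only [Measure.smul_apply, measure_univ, smul_eq_mul, mul_one]
    rw [← ENNReal.ofReal_sum_of_nonneg fun a _ => θ.2.1 a, θ.2.2, ENNReal.ofReal_one]⟩⟩

variable [MeasurableSingletonClass A]

lemma simplexMeasure_singleton (θ : stdSimplex ℝ A) (a : A) :
    (simplexMeasure θ : Measure A) {a} = ENNReal.ofReal (θ.1 a) := by
  classical
  change (∑ a, ENNReal.ofReal (θ.1 a) • Measure.dirac a : Measure A) {a} = _
  rw [Measure.finsetSum_apply]
  simp [Set.indicator_apply]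

lemma simplexMeasure_surjective : Function.Surjective (simplexMeasure (A := A)) := by
  intro p
  refine ⟨⟨fun a => ((p : Measure A) {a}).toReal, fun a => ENNReal.toReal_nonneg, ?_⟩,
    Subtype.ext (Measure.ext_iff_singleton.2 fun a => ?_)⟩
  · rw [← ENNReal.toReal_sum fun a _ => measure_ne_top _ _]
    simp
  · exact (simplexMeasure_singleton _ a).trans (ENNReal.ofReal_toReal (measure_ne_top _ _))

end Simplex

namespace ManyToOneChannel

variable {n : ℕ} {X Y : Fin (n + 1) → Type*} {V : Type*}
  [∀ i, MeasurableSpace (X i)] [∀ i, MeasurableSpace (Y i)] [MeasurableSpace V]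
  (C : ManyToOneChannel n X Y V) [∀ i, MeasurableSingletonClass (X i)]

lemma prod_mul_channel_le_snd_userLaw (p : ∀ i, ProbabilityMeasure (X i)) (i : Fin (n + 1))
    (x : ∀ j, X j) {t : Set (Y i)} (ht : MeasurableSet t) :
    (∏ j, (p j : Measure (X j)) {x j}) * C.channel x {y | y i ∈ t} ≤ (C.userLaw p i).snd t := by
  have hpair : Measurable fun z : (∀ i, X i) × (∀ i, Y i) => (z.1 i, z.2 i) := by fun_prop
  have ht' : MeasurableSet (Prod.snd ⁻¹' t : Set (X i × Y i)) := ht.preimage measurable_snd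
  rw [Measure.snd_apply ht, userLaw, Measure.map_apply hpair ht',
    Measure.compProd_apply (hpair ht'), ← Measure.pi_singleton, mul_comm]
  exact (lintegral_singleton (fun x => C.channel x {y | y i ∈ t}) x).symm.trans_le
    (setLIntegral_le_lintegral _ _)

lemma exists_map_channel_le_smul {p : ∀ i, ProbabilityMeasure (X i)}
    (hp : ∀ i a, (p i : Measure (X i)) {a} ≠ 0) (i : Fin (n + 1)) (x : ∀ j, X j) :
    ∃ c : ℝ≥0∞, c ≠ ∞ ∧ (C.channel x).map (fun y => (x i, y i)) ≤
      c • (p i : Measure (X i)).prod (C.userLaw p i).snd := by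
  set w := ∏ j, (p j : Measure (X j)) {x j}
  set d := (p i : Measure (X i)) {x i}
  have hwd₀ : w * d ≠ 0 :=
    mul_ne_zero (Finset.prod_ne_zero_iff.2 fun j _ => hp j (x j)) (hp i (x i))
  have hwd : w * d ≠ ∞ :=
    ENNReal.mul_ne_top (ENNReal.prod_ne_top fun j _ => measure_ne_top _ _) (measure_ne_top _ _)
  refine ⟨(w * d)⁻¹, ENNReal.inv_ne_top.2 hwd₀, Measure.le_iff.2 fun s hs => ?_⟩
  rw [Measure.map_apply (by fun_prop) hs, Measure.smul_apply, smul_eq_mul,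
    ← ENNReal.mul_le_iff_le_inv hwd₀ hwd]
  set t := Prod.mk (x i) ⁻¹' s
  have ht : MeasurableSet t := hs.preimage measurable_prodMk_left
  have hsub : {x i} ×ˢ t ⊆ s := by
    rintro ⟨_, y⟩ ⟨rfl, hy⟩
    exact hy
  calc w * d * C.channel x {y | y i ∈ t}
      = d * (w * C.channel x {y | y i ∈ t}) := by ring
    _ ≤ d * (C.userLaw p i).snd t := by
        gcongr
        exact C.prod_mul_channel_le_snd_userLaw p i x ht
    _ = ((p i : Measure (X i)).prod (C.userLaw p i).snd) ({x i} ×ˢ t) :=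
        (Measure.prod_prod _ _).symm
    _ ≤ ((p i : Measure (X i)).prod (C.userLaw p i).snd) s := measure_mono hsub

lemma userLaw_eq_sum [∀ i, Fintype (X i)] (p : ∀ i, ProbabilityMeasure (X i)) (i : Fin (n + 1)) :
    C.userLaw p i = ∑ x : ∀ j, X j,
      (∏ j, (p j : Measure (X j)) {x j}) • (C.channel x).map fun y => (x i, y i) := by
  ext s hs
  have hpair : Measurable fun z : (∀ i, X i) × (∀ i, Y i) => (z.1 i, z.2 i) := by fun_prop
  rw [userLaw, Measure.map_apply hpair hs, Measure.compProd_apply (hpair hs), lintegral_fintype,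
    Measure.finsetSum_apply]
  refine Finset.sum_congr rfl fun x _ => ?_
  rw [Measure.smul_apply, Measure.map_apply (by fun_prop) hs, Measure.pi_singleton, smul_eq_mul,
    mul_comm]
  rfl

variable [∀ i, Nonempty (X i)]

lemma userInfo_simplexMeasure_ne_top_and_continuous [∀ i, Fintype (X i)] (i : Fin (n + 1)) :
    (∀ θ : ∀ j, stdSimplex ℝ (X j), C.userInfo (fun j => simplexMeasure (θ j)) i ≠ ∞) ∧
      Continuous fun θ : ∀ j, stdSimplex ℝ (X j) =>
        (C.userInfo (fun j => simplexMeasure (θ j)) i).toReal := by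
  let uniform (j : Fin (n + 1)) : stdSimplex ℝ (X j) :=
    ⟨fun _ => (Fintype.card (X j) : ℝ)⁻¹, fun _ => by positivity, by simp⟩
  have huniform (j : Fin (n + 1)) (a : X j) :
      (simplexMeasure (uniform j) : Measure (X j)) {a} ≠ 0 := by
    rw [simplexMeasure_singleton]
    simp [uniform, Fintype.card_pos]
  choose c hc hle using C.exists_map_channel_le_smul huniform i
  refine mutualInformation_ne_top_and_continuous_mixture hc hle
    (g := fun (θ : ∀ j, stdSimplex ℝ (X j)) x => ∏ j, (θ j).1 (x j))
    (fun x => continuous_finsetProd _ fun j _ =>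
      (continuous_apply (x j)).comp (continuous_subtype_val.comp (continuous_apply j)))
    (fun θ x => ⟨Finset.prod_nonneg fun j _ => (θ j).2.1 _, Finset.prod_le_one
      (fun j _ => (θ j).2.1 _) fun j _ => (mem_Icc_of_mem_stdSimplex (θ j).2 _).2⟩)
    (fun θ => C.userLaw (fun j => simplexMeasure (θ j)) i) fun θ => ?_
  rw [userLaw_eq_sum]
  refine Finset.sum_congr rfl fun x _ => ?_
  simp_rw [ENNReal.ofReal_prod_of_nonneg fun j _ => (θ j).2.1 (x j), simplexMeasure_singleton]

lemma exists_isMax_sum_userInfo [∀ i, Finite (X i)] : ∃ p : ∀ i, ProbabilityMeasure (X i),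
    (∀ p' : ∀ i, ProbabilityMeasure (X i), ∑ i, C.userInfo p' i ≤ ∑ i, C.userInfo p i) ∧
      ∑ i, C.userInfo p i ≠ ∞ := by
  have (i : Fin (n + 1)) : Fintype (X i) := Fintype.ofFinite (X i)
  have hinfo := C.userInfo_simplexMeasure_ne_top_and_continuous
  have hfin (θ : ∀ j, stdSimplex ℝ (X j)) :
      ∑ i, C.userInfo (fun j => simplexMeasure (θ j)) i ≠ ∞ :=
    ENNReal.sum_ne_top.2 fun i _ => (hinfo i).1 θ
  have hcont : Continuous fun θ : ∀ j, stdSimplex ℝ (X j) =>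
      (∑ i, C.userInfo (fun j => simplexMeasure (θ j)) i).toReal :=
    (continuous_finsetSum Finset.univ fun i _ => (hinfo i).2).congr fun θ =>
      (ENNReal.toReal_sum fun i _ => (hinfo i).1 θ).symm
  obtain ⟨θ, -, hθ⟩ := isCompact_univ.exists_isMaxOn Set.univ_nonempty hcont.continuousOn
  refine ⟨fun j => simplexMeasure (θ j), fun p' => ?_, hfin θ⟩
  choose θ' hθ' using fun j => simplexMeasure_surjective (p' j)
  obtain rfl : (fun j => simplexMeasure (θ' j)) = p' := funext hθ'
  exact (ENNReal.toReal_le_toReal (hfin θ') (hfin θ)).1 (hθ (Set.mem_univ θ'))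

end ManyToOneChannel

end

theorem theorem1 {n : ℕ} {X Y : Fin (n + 1) → Type*} {V : Type*}
    [∀ i, MeasurableSpace (X i)] [∀ i, MeasurableSpace (Y i)] [MeasurableSpace V]
    [∀ i, Nonempty (X i)]
    (C : ManyToOneChannel n X Y V) (hC : C.IsDegraded) :
    -- the sum-capacity formula
    C.sumCapacity = ⨆ p : ∀ i, ProbabilityMeasure (X i), ∑ i, C.userInfo p i ∧
    -- the sum-capacity is achieved by random coding with interference treated as noise
    C.sumCapacity = ⨆ (p : ∀ i, ProbabilityMeasure (X i)) (R : Fin (n + 1) → ℝ)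
      (_ : C.RandomCodingAchieves p R), ENNReal.ofReal (∑ i, R i) ∧
    -- with input laws `p` it achieves all rates below the single-letter mutual informations
    (∀ (p : ∀ i, ProbabilityMeasure (X i)) (R : Fin (n + 1) → ℝ),
      (∀ i, 0 ≤ R i ∧ (R i = 0 ∨ ENNReal.ofReal (R i) < C.userInfo p i)) →
        C.RandomCodingAchieves p R) ∧
    -- for finite input alphabets, the suprema are finite and are maxima
    ((∀ i, Finite (X i)) → (∀ i, MeasurableSingletonClass (X i)) →
      ∃ p : ∀ i, ProbabilityMeasure (X i),
        (∀ p' : ∀ i, ProbabilityMeasure (X i),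
          ∑ i, C.userInfo p' i ≤ ∑ i, C.userInfo p i) ∧
        ∑ i, C.userInfo p i ≠ ∞ ∧
        IsGreatest ((fun R : Fin (n + 1) → ℝ => ∑ i, R i) '' C.capacityRegion)
          (∑ i, C.userInfo p i).toReal) := by
  refine ⟨C.sumCapacity_eq hC, C.sumCapacity_eq_iSup_randomCoding hC,
    fun p R (hR : C.IsBelowUserInfo p R) => hR.randomCodingAchieves, fun hfin hsing => ?_⟩
  obtain ⟨p, hp, hp'⟩ := C.exists_isMax_sum_userInfo
  exact ⟨p, hp, hp', C.isGreatest_sum_capacityRegion hC hp hp'⟩
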